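/- **Setting.** Let $V=\{1,\dots,n\}$. A set function $g:2^V\to\mathbb R$ is called *monotone submodular* here if it is nonnegative, $g(A)\le g(B)$ for $A\subseteq B$, and $g(A)+g(B)\ge g(A\cap B)+g(A\cup B)$ for all $A,B$. Its multilinear extension is $G(x)=\sum_{S\subseteq V} g(S)\prod_{i\in S}x_i\prod_{j\notin S}(1-x_j)$. Let $\mathcal I$ be the family of independent sets of a matroid on $V$ of rank at most $r$, let $\mathcal C=\mathrm{conv}\{1_I: I\in\mathcal I\}$ be its matroid polytope, let $f$ be a monotone submodular function with multilinear extension $F$, and put $m_f=\max_j f(\{j\})$ and $\mathrm{OPT}=\max_{x\in\mathcal C}F(x)$. An *unbiased stochastic gradient* is a measurable map $(x,z)\mapsto\nabla\tilde F(x,z)\in\mathbb R^n$ with $\mathbb E_{z\sim P}[\nabla\tilde F(x,z)]=\nabla F(x)$ for $x\in[0,1]^n$, where $P$ is a probability distribution. Its variance is bounded by $\sigma^2$ if $\mathbb E_{z\sim P}\|\nabla\tilde F(x,z)-\nabla F(x)\|^2\le\sigma^2$ for all $x\in[0,1]^n$. **Stochastic Continuous Greedy (SCG)** with $T\ge 1$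 iterations starts from $x_{t_0}=0$ and $d_0=0$ and performs, for $t=t_0,\dots,t_0+T-1$, $$d_t=(1-\rho_t)d_{t-1}+\rho_t\nabla\tilde F(x_t,z_t)\ \ (t\ge1),\qquad v_t\in\arg\max_{v\in\mathcal C}\langle d_t,v\rangle,\qquad x_{t+1}=x_t+\tfrac1T v_t,$$ with $\rho_t=4/(t+8)^{2/3}$, where $z_t\sim P$ is independent of the history before time $t$ and $v_t$ is any maximizer chosen measurably from the history up to time $t$. The numbering may start at $t_0=0$ (then $v_0\in\mathcal C$ is arbitrary, as $d_0=0$) or at $t_0=1$. The output is $x_{\mathrm{out}}=x_{t_0+T}$. **Statement.** For all $r\in\mathbb N$ and $m,\kappa\in\mathbb R$ there is a constant $C>0$, depending only on $r,m,\kappa$, such that the following hold for every $n$, every such matroid of rank at most $r$ and every probability distribution $P$. 1. Let $f(S)=\mathbb E_{z\sim P}[\tilde f(S,z)]$, where each $\tilde f(S,\cdot)$ is measurable and integrable, $\tilde f(\cdot,z)$ is monotone submodular for $P$-almost every $z$, and $\mathbb E[\tilde f(\{j\},z)^2]<\infty$ for all $j$. Let $\nabla\tilde F(x,z)$ be the gradient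 in $x$ of the multilinear extension $\tilde F(\cdot,z)$ of $\tilde f(\cdot,z)$. Then the variance of $\nabla\tilde F$ is bounded by $\sigma^2$ with $$\sigma=\sqrt n\,\max_{j}\mathbb E[\tilde f(\{j\},z)^2]^{1/2}.$$ If moreover $m_f\le m$ and $\max_j\mathbb E[\tilde f(\{j\},z)^2]^{1/2}\le\kappa$, then for every $\varepsilon>0$ and every integer $T\ge1$ with $T\ge C\,n^{3/2}/\varepsilon^3$, every run of SCG with $T$ iterations satisfies $$x_{\mathrm{out}}\in\mathcal C\qquad\text{and}\qquad \mathbb E[F(x_{\mathrm{out}})]\ \ge\ (1-1/e)\,\mathrm{OPT}-\varepsilon .$$ 2. The same guarantee holds, with the same $C$, for every monotone submodular $f$ with $m_f\le m$ and every unbiased stochastic gradient of $F$ whose variance is bounded by $\sigma^2=n\kappa^2$ (nothing being assumed about individual realizations). -/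

import Mathlib

open MeasureTheory ProbabilityTheory

universe u v

/-- Submodularity of a set function on the ground set `V = {1, …, n}`. -/
def IsSubmodular {n : ℕ} (f : Finset (Fin n) → ℝ) : Prop :=
  ∀ A B : Finset (Fin n), f (A ∩ B) + f (A ∪ B) ≤ f A + f B

/-- A nonnegative, monotone, submodular set function. -/
structure IsMonotoneSubmodular {n : ℕ} (f : Finset (Fin n) → ℝ) : Prop where
  nonneg : ∀ S, 0 ≤ f S
  mono : Monotone f
  submodular : IsSubmodular f

/-- The multilinear extension `F(x) = ∑_S f(S) ∏_{i ∈ S} x_i ∏_{j ∉ S} (1 - x_j)`. -/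
noncomputable def multilinearExt {n : ℕ} (f : Finset (Fin n) → ℝ)
    (x : EuclideanSpace ℝ (Fin n)) : ℝ :=
  ∑ S : Finset (Fin n), f S * ((∏ i ∈ S, x i) * ∏ j ∈ Sᶜ, (1 - x j))

/-- The cube `[0,1]^n`, the domain of multilinear extensions. -/
def unitCube (n : ℕ) : Set (EuclideanSpace ℝ (Fin n)) :=
  {x | ∀ i, 0 ≤ x i ∧ x i ≤ 1}

/-- The indicator vector `1_I`. -/
noncomputable def indicatorVec {n : ℕ} (I : Finset (Fin n)) : EuclideanSpace ℝ (Fin n) :=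
  WithLp.toLp 2 (fun i => if i ∈ I then 1 else 0)

/-- The matroid polytope `conv {1_I : I independent}`. -/
noncomputable def matroidPolytope {n : ℕ} (M : Matroid (Fin n)) :
    Set (EuclideanSpace ℝ (Fin n)) :=
  convexHull ℝ {y | ∃ I : Finset (Fin n), M.Indep (I : Set (Fin n)) ∧ y = indicatorVec I}

/-- `OPT = max_{x ∈ 𝒞} F(x)`; for a continuous `F` and a matroid polytope `𝒞` (compact and
nonempty) the supremum is attained. -/
noncomputable def optValue {n : ℕ} (F : EuclideanSpace ℝ (Fin n) → ℝ)
    (𝒞 : Set (EuclideanSpace ℝ (Fin n))) : ℝ :=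
  sSup (F '' 𝒞)

/-- `m_f = max_j f({j})`. -/
noncomputable def maxSingleton {n : ℕ} (f : Finset (Fin n) → ℝ) : ℝ :=
  ⨆ j : Fin n, f {j}

/-- The averaging parameters `ρ_t = 4 / (t + 8)^{2/3}`. -/
noncomputable def scgRho (t : ℕ) : ℝ := 4 / ((t : ℝ) + 8) ^ (2 / 3 : ℝ)

section Stochastic

variable {n : ℕ} {Z : Type v} [MeasurableSpace Z]

/-- The expected set function `f(S) = E_{z ∼ P} [f̃(S, z)]`. -/
noncomputable def expectedSetFun (P : Measure Z) (ft : Finset (Fin n) → Z → ℝ) :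
    Finset (Fin n) → ℝ :=
  fun S => ∫ z, ft S z ∂P

/-- The stochastic gradient `∇F̃(x, z)`, where `F̃(·, z)` is the multilinear extension of
`f̃(·, z)`. -/
noncomputable def stochGrad (ft : Finset (Fin n) → Z → ℝ) (x : EuclideanSpace ℝ (Fin n)) (z : Z) :
    EuclideanSpace ℝ (Fin n) :=
  gradient (multilinearExt (fun S => ft S z)) x

/-- `max_j E_{z ∼ P} [f̃({j}, z)²]^{1/2}`. -/
noncomputable def maxSecondMoment (P : Measure Z) (ft : Finset (Fin n) → Z → ℝ) : ℝ :=
  ⨆ j : Fin n, √(∫ z, ft {j} z ^ 2 ∂P)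

/-- `G(x, z)`, with `z ∼ P`, is an unbiased stochastic gradient of `F` on `[0,1]^n`. -/
structure IsUnbiasedGrad (P : Measure Z) (F : EuclideanSpace ℝ (Fin n) → ℝ)
    (G : EuclideanSpace ℝ (Fin n) → Z → EuclideanSpace ℝ (Fin n)) : Prop where
  measurable : Measurable (Function.uncurry G)
  integrable : ∀ x ∈ unitCube n, Integrable (G x) P
  unbiased : ∀ x ∈ unitCube n, ∫ z, G x z ∂P = gradient F x

/-- The variance of `G(x, z)`, `z ∼ P`, around `∇F(x)` is at most `σ²` for all `x ∈ [0,1]^n`. -/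
def BoundedVariance (P : Measure Z) (F : EuclideanSpace ℝ (Fin n) → ℝ)
    (G : EuclideanSpace ℝ (Fin n) → Z → EuclideanSpace ℝ (Fin n)) (σ : ℝ) : Prop :=
  ∀ x ∈ unitCube n, Integrable (fun z => ‖G x z - gradient F x‖ ^ 2) P ∧
    ∫ z, ‖G x z - gradient F x‖ ^ 2 ∂P ≤ σ ^ 2

/-- `T` iterations of Stochastic Continuous Greedy over `𝒞` with stochastic gradients `G(x, z)`.
The iterations are `t = t₀, …, t₀ + T - 1`, where `t₀` is `0` or `1`; the output is `x_{t₀ + T}`.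
(For `t₀ = 0` the first direction `v_0` is an arbitrary point of `𝒞`, as `d_0 = 0`.)
`ℱ_t` is the history up to time `t`: the sample `z_t` has law `P` and is independent of the history
up to time `t - 1`, and `v_t` may depend only on the history up to time `t`. -/
structure IsSCGRun {Ω : Type u} {mΩ : MeasurableSpace Ω} (μ : Measure Ω) (ℱ : Filtration ℕ mΩ)
    (P : Measure Z) (𝒞 : Set (EuclideanSpace ℝ (Fin n)))
    (G : EuclideanSpace ℝ (Fin n) → Z → EuclideanSpace ℝ (Fin n)) (T t₀ : ℕ)
    (z : ℕ → Ω → Z) (d v x : ℕ → Ω → EuclideanSpace ℝ (Fin n)) : Prop where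
  start_le : t₀ ≤ 1
  sample_measurable : ∀ t, 1 ≤ t → t < t₀ + T → Measurable[ℱ t] (z t)
  sample_law : ∀ t, 1 ≤ t → t < t₀ + T → μ.map (z t) = P
  sample_indep : ∀ t, 1 ≤ t → t < t₀ + T →
    Indep (ℱ (t - 1)) (MeasurableSpace.comap (z t) inferInstance) μ
  d_zero : ∀ ω, d 0 ω = 0
  x_zero : ∀ t, t ≤ t₀ → ∀ ω, x t ω = 0
  d_step : ∀ t, 1 ≤ t → t < t₀ + T → ∀ ω,
    d t ω = (1 - scgRho t) • d (t - 1) ω + scgRho t • G (x t ω) (z t ω)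
  v_measurable : ∀ t, t₀ ≤ t → t < t₀ + T → Measurable[ℱ t] (v t)
  v_mem : ∀ t, t₀ ≤ t → t < t₀ + T → ∀ ω, v t ω ∈ 𝒞
  v_max : ∀ t, t₀ ≤ t → t < t₀ + T → ∀ ω, IsMaxOn (fun w => inner ℝ (d t ω) w) 𝒞 (v t ω)
  x_step : ∀ t, t₀ ≤ t → t < t₀ + T → ∀ ω, x (t + 1) ω = x t ω + (1 / (T : ℝ)) • v t ω

/-- Every run of Stochastic Continuous Greedy with `T` iterations outputs a point of `𝒞` whose
expected value is at least `(1 - 1/e) OPT - ε`. -/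
def SCGAchieves (P : Measure Z) (F : EuclideanSpace ℝ (Fin n) → ℝ)
    (𝒞 : Set (EuclideanSpace ℝ (Fin n)))
    (G : EuclideanSpace ℝ (Fin n) → Z → EuclideanSpace ℝ (Fin n)) (T : ℕ) (ε : ℝ) : Prop :=
  ∀ (Ω : Type u) (mΩ : MeasurableSpace Ω) (μ : Measure Ω) (_ : IsProbabilityMeasure μ)
    (ℱ : Filtration ℕ mΩ) (t₀ : ℕ) (z : ℕ → Ω → Z)
    (d v x : ℕ → Ω → EuclideanSpace ℝ (Fin n)),
    IsSCGRun μ ℱ P 𝒞 G T t₀ z d v x →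
      (∀ ω, x (t₀ + T) ω ∈ 𝒞) ∧
      Integrable (fun ω => F (x (t₀ + T) ω)) μ ∧
      (1 - 1 / Real.exp 1) * optValue F 𝒞 - ε ≤ ∫ ω, F (x (t₀ + T) ω) ∂μ

/-- The data of a stochastic set function whose realizations `f̃(·, z)` are, almost surely,
nonnegative, monotone and submodular, with finite second moments `E[f̃({j}, z)²]`. -/
structure IsStochMonotoneSubmodular (P : Measure Z) (ft : Finset (Fin n) → Z → ℝ) : Prop where
  measurable : ∀ S, Measurable (ft S)
  integrable : ∀ S, Integrable (ft S) P
  moment : ∀ j : Fin n, Integrable (fun z => ft {j} z ^ 2) P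
  realization : ∀ᵐ z ∂P, IsMonotoneSubmodular (fun S => ft S z)

end Stochastic

/-!
The value of a run of Stochastic Continuous Greedy is controlled by two estimates.

*Geometry of the multilinear extension.* The partial derivative `∂_j F` is the multilinear extension
of the discrete derivative `S ↦ f (S ∪ {j}) - f (S \ {j})` (`hasGradientAt_multilinearExt`), and on
the cube a multilinear extension takes values between the bounds of its set function. Applying this
once and twice, for monotone submodular `f` the gradient of `F` has coordinates in `[0, m_f]`, and
the second partial derivatives lie in `[-m_f, 0]`. Hence `F` is increasing, concave in nonnegative
directions, and `∇F` has coordinates that are `m_f`-Lipschitz for the `ℓ¹`-norm. Monotonicity and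
concavity give `F(y) - F(x) ≤ ⟨∇F(x), y⟩` (`IsMonotoneSubmodular.sub_le_inner_grad`). As points of
the polytope have `ℓ¹`-norm at most `r`, a step in the direction `v_t`, optimal for the estimate
`d_t`, closes a `1/T` fraction of the gap to `F(y)`, up to an error
`(2r/T) ‖∇F(x_t) - d_t‖ + m_f r²/T²` (`IsSCGRun.progress`).

*Averaging of the gradients.* With `W = ∇F(x_t) - d_{t-1}` and the noise
`ξ = ∇F(x_t) - G(x_t, z_t)`, the error `∇F(x_t) - d_t` equals `(1 - ρ_t) W + ρ_t ξ`. Since `z_t` is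
independent of the past, `ξ` is orthogonal to `W` in `L²` and has second moment at most `σ²`
(`noise_estimates`). The drift `∇F(x_t) - ∇F(x_{t-1})` is `O(√n m_f r / T)`, so the mean squared error
`a_t` satisfies `a_t ≤ (1 - ρ_t) a_{t-1} + O((σ² + n m_f² r²) ρ_t²)`, whence `a_t ≤ Q (t + 8)^{-2/3}`
with `Q = O(σ² + n m_f² (r² + 1))` (`IsSCGRun.integral_gradError_sq_le`).

Summing `√Q (t + 8)^{-1/3}` over the run gives a total error of order `r √Q / T^{1/3}` in addition to
`(1 - 1/T)^T F(y) ≤ F(y) / e` (`IsSCGRun.le_integral_output`). For `σ = √n κ` one has `√Q = O(√n)`,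
so that `T ≥ C n^{3/2} / ε³` steps suffice.

For a stochastic submodular function the coordinates of `∇F̃(x, z)` lie in `[0, f̃({j}, z)]` almost
surely, so their variances are at most `E[f̃({j}, z)²]`, which bounds the variance of the stochastic
gradient (`IsStochMonotoneSubmodular.boundedVariance_stochGrad`).
-/

/-! ### Calculus of multilinear extensions -/

section Multilinear

variable {n : ℕ}

/-- The discrete partial derivative `S ↦ f (S ∪ {j}) - f (S \ {j})` of a set function. -/
def discDeriv (f : Finset (Fin n) → ℝ) (j : Fin n) : Finset (Fin n) → ℝ :=
  fun S => f (insert j S) - f (S.erase j)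

/-- The vector of multilinear extensions of the discrete partial derivatives of `f`; it is the
gradient of the multilinear extension of `f`, see `gradient_multilinearExt`. -/
noncomputable def multilinearGrad (f : Finset (Fin n) → ℝ) (x : EuclideanSpace ℝ (Fin n)) :
    EuclideanSpace ℝ (Fin n) :=
  WithLp.toLp 2 fun j => multilinearExt (discDeriv f j) x

@[simp]
lemma multilinearGrad_apply (f : Finset (Fin n) → ℝ) (x : EuclideanSpace ℝ (Fin n)) (j : Fin n) :
    multilinearGrad f x j = multilinearExt (discDeriv f j) x := rfl

lemma multilinearExt_eq_sum_prod_ite (f : Finset (Fin n) → ℝ) (x : EuclideanSpace ℝ (Fin n)) :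
    multilinearExt f x = ∑ S : Finset (Fin n), f S * ∏ i, if i ∈ S then x i else 1 - x i := by
  unfold multilinearExt
  refine Finset.sum_congr rfl fun S _ => ?_
  rw [Finset.prod_ite]
  congr 3
  · ext i; simp
  · ext i; simp

/-- Splitting a sum over all sets according to whether they contain `j`. -/
lemma sum_finset_eq_sum_erase (j : Fin n) (h : Finset (Fin n) → ℝ) :
    ∑ S, h S = ∑ S ∈ (Finset.univ.erase j).powerset, (h S + h (insert j S)) := by
  have h1 := Finset.sum_powerset_insert (Finset.notMem_erase j Finset.univ) h
  rw [Finset.insert_erase (Finset.mem_univ j), Finset.powerset_univ] at h1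
  rw [h1, Finset.sum_add_distrib]

/-- The partial derivative of the multilinear extension of `f`, written as the sum of the partial
derivatives of its monomials, is the multilinear extension of the discrete derivative. -/
lemma sum_prod_erase_eq_multilinearExt_discDeriv (f : Finset (Fin n) → ℝ)
    (x : EuclideanSpace ℝ (Fin n)) (j : Fin n) :
    ∑ S : Finset (Fin n), f S * ((∏ i ∈ Finset.univ.erase j, if i ∈ S then x i else 1 - x i) *
      (if j ∈ S then 1 else -1)) = multilinearExt (discDeriv f j) x := by
  rw [multilinearExt_eq_sum_prod_ite, sum_finset_eq_sum_erase j, sum_finset_eq_sum_erase j]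
  refine Finset.sum_congr rfl fun S hS => ?_
  have hj : j ∉ S := fun h => by simpa using Finset.mem_powerset.1 hS h
  have hprod : (∏ i ∈ Finset.univ.erase j, if i ∈ insert j S then x i else 1 - x i) =
      ∏ i ∈ Finset.univ.erase j, if i ∈ S then x i else 1 - x i := by
    refine Finset.prod_congr rfl fun i hi => ?_
    simp [Finset.ne_of_mem_erase hi]
  rw [← Finset.mul_prod_erase Finset.univ _ (Finset.mem_univ j),
    ← Finset.mul_prod_erase Finset.univ (fun i => if i ∈ insert j S then x i else 1 - x i)
      (Finset.mem_univ j), hprod]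
  simp only [discDeriv, hj, Finset.mem_insert_self, if_true, if_false, Finset.insert_idem,
    Finset.erase_insert hj, Finset.erase_eq_of_notMem hj]
  ring

lemma hasGradientAt_multilinearExt (f : Finset (Fin n) → ℝ) (x : EuclideanSpace ℝ (Fin n)) :
    HasGradientAt (multilinearExt f) (multilinearGrad f x) x := by
  have hfac (S : Finset (Fin n)) (i : Fin n) :
      HasFDerivAt (fun y : EuclideanSpace ℝ (Fin n) => if i ∈ S then y i else 1 - y i)
        ((if i ∈ S then (1 : ℝ) else -1) • (EuclideanSpace.proj i : _ →L[ℝ] ℝ)) x := by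
    have hi : HasFDerivAt (fun y : EuclideanSpace ℝ (Fin n) => y i)
      (EuclideanSpace.proj i : _ →L[ℝ] ℝ) x := (EuclideanSpace.proj i : _ →L[ℝ] ℝ).hasFDerivAt
    by_cases h : i ∈ S
    · simpa [h] using hi
    · simpa [h] using hi.const_sub 1
  have hsum := HasFDerivAt.fun_sum (u := Finset.univ) fun (S : Finset (Fin n)) _ =>
    (HasFDerivAt.finsetProd (u := Finset.univ) fun i _ => hfac S i).const_mul (f S)
  rw [hasGradientAt_iff_hasFDerivAt, show multilinearExt f = _ from
    funext (multilinearExt_eq_sum_prod_ite f)]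
  refine hsum.congr_fderiv (ContinuousLinearMap.ext fun v => Eq.symm ?_)
  simp only [InnerProductSpace.toDual_apply_apply, PiLp.inner_apply, multilinearGrad_apply,
    ← sum_prod_erase_eq_multilinearExt_discDeriv, sum_apply,
    smul_apply, smul_eq_mul, Finset.mul_sum, RCLike.inner_apply, conj_trivial,
    PiLp.proj_apply]
  rw [Finset.sum_comm]
  refine Finset.sum_congr rfl fun S _ => Finset.sum_congr rfl fun j _ => ?_
  ring

lemma gradient_multilinearExt (f : Finset (Fin n) → ℝ) (x : EuclideanSpace ℝ (Fin n)) :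
    gradient (multilinearExt f) x = multilinearGrad f x :=
  (hasGradientAt_multilinearExt f x).gradient

lemma continuous_multilinearExt (f : Finset (Fin n) → ℝ) : Continuous (multilinearExt f) := by
  unfold multilinearExt
  fun_prop

lemma continuous_multilinearGrad (f : Finset (Fin n) → ℝ) : Continuous (multilinearGrad f) :=
  (PiLp.continuous_toLp 2 _).comp (continuous_pi fun _ => continuous_multilinearExt _)

lemma multilinearExt_zero (f : Finset (Fin n) → ℝ) : multilinearExt f 0 = f ∅ := by
  rw [multilinearExt_eq_sum_prod_ite, Finset.sum_eq_single ∅]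
  · simp
  · intro S _ hS
    obtain ⟨i, hi⟩ := Finset.nonempty_iff_ne_empty.2 hS
    rw [Finset.prod_eq_zero (Finset.mem_univ i) (by simp [hi]), mul_zero]
  · simp

lemma multilinearExt_const (c : ℝ) (x : EuclideanSpace ℝ (Fin n)) :
    multilinearExt (fun _ => c) x = c := by
  unfold multilinearExt
  rw [← Finset.mul_sum]
  have h := Finset.prod_add (fun i => x i) (fun i => 1 - x i) Finset.univ
  simp only [add_sub_cancel, Finset.prod_const_one, Finset.powerset_univ,
    ← Finset.compl_eq_univ_sdiff] at h
  rw [← h, mul_one]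

lemma multilinearExt_mono {f g : Finset (Fin n) → ℝ} (h : ∀ S, f S ≤ g S)
    {x : EuclideanSpace ℝ (Fin n)} (hx : x ∈ unitCube n) :
    multilinearExt f x ≤ multilinearExt g x := by
  unfold multilinearExt
  refine Finset.sum_le_sum fun S _ => mul_le_mul_of_nonneg_right (h S) ?_
  exact mul_nonneg (Finset.prod_nonneg fun i _ => (hx i).1)
    (Finset.prod_nonneg fun i _ => sub_nonneg.2 (hx i).2)

lemma multilinearExt_le {f : Finset (Fin n) → ℝ} {b : ℝ} (h : ∀ S, f S ≤ b)
    {x : EuclideanSpace ℝ (Fin n)} (hx : x ∈ unitCube n) : multilinearExt f x ≤ b :=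
  (multilinearExt_mono h hx).trans_eq (multilinearExt_const b x)

lemma le_multilinearExt {f : Finset (Fin n) → ℝ} {a : ℝ} (h : ∀ S, a ≤ f S)
    {x : EuclideanSpace ℝ (Fin n)} (hx : x ∈ unitCube n) : a ≤ multilinearExt f x :=
  (multilinearExt_const a x).symm.trans_le (multilinearExt_mono h hx)

lemma convex_unitCube (n : ℕ) : Convex ℝ (unitCube n) := by
  intro x hx y hy a b ha hb hab i
  have hx := hx i
  have hy := hy i
  simp only [PiLp.add_apply, PiLp.smul_apply, smul_eq_mul]
  constructor
  · exact add_nonneg (mul_nonneg ha hx.1) (mul_nonneg hb hy.1)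
  · nlinarith

/-- The mean value theorem for multilinear extensions. -/
lemma exists_multilinearExt_sub_eq (f : Finset (Fin n) → ℝ) (x y : EuclideanSpace ℝ (Fin n)) :
    ∃ w ∈ segment ℝ x y,
      multilinearExt f y - multilinearExt f x =
        ∑ i, multilinearExt (discDeriv f i) w * (y i - x i) := by
  obtain ⟨w, hw, h⟩ := domain_mvt (f := multilinearExt f)
    (fun z _ => (hasGradientAt_multilinearExt f z).hasFDerivAt.hasFDerivWithinAt)
    (convex_univ) (Set.mem_univ x) (Set.mem_univ y)
  refine ⟨w, hw, ?_⟩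
  rw [h, InnerProductSpace.toDual_apply_apply, PiLp.inner_apply]
  refine Finset.sum_congr rfl fun i _ => ?_
  simp [mul_comm]

lemma multilinearExt_antitone {f : Finset (Fin n) → ℝ} (h : ∀ i S, discDeriv f i S ≤ 0)
    {x y : EuclideanSpace ℝ (Fin n)} (hx : x ∈ unitCube n) (hy : y ∈ unitCube n)
    (hxy : ∀ i, x i ≤ y i) : multilinearExt f y ≤ multilinearExt f x := by
  obtain ⟨w, hw, h'⟩ := exists_multilinearExt_sub_eq f x y
  have hw' := (convex_unitCube n).segment_subset hx hy hw
  rw [← sub_nonpos, h']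
  exact Finset.sum_nonpos fun i _ => mul_nonpos_of_nonpos_of_nonneg (multilinearExt_le (h i) hw')
    (sub_nonneg.2 (hxy i))

lemma abs_multilinearExt_sub_le {f : Finset (Fin n) → ℝ} {b : ℝ}
    (h : ∀ i S, |discDeriv f i S| ≤ b) {x y : EuclideanSpace ℝ (Fin n)} (hx : x ∈ unitCube n)
    (hy : y ∈ unitCube n) :
    |multilinearExt f y - multilinearExt f x| ≤ b * ∑ i, |y i - x i| := by
  obtain ⟨w, hw, h'⟩ := exists_multilinearExt_sub_eq f x y
  have hw' := (convex_unitCube n).segment_subset hx hy hw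
  rw [h', Finset.mul_sum]
  refine (Finset.abs_sum_le_sum_abs _ _).trans (Finset.sum_le_sum fun i _ => ?_)
  rw [abs_mul]
  refine mul_le_mul_of_nonneg_right (abs_le.2 ⟨?_, ?_⟩) (abs_nonneg _)
  · exact le_multilinearExt (fun S => (abs_le.1 (h i S)).1) hw'
  · exact multilinearExt_le (fun S => (abs_le.1 (h i S)).2) hw'

end Multilinear

/-! ### Multilinear extensions of monotone submodular functions -/

section Submodular

variable {n : ℕ} {f : Finset (Fin n) → ℝ}

lemma IsMonotoneSubmodular.discDeriv_nonneg (hf : IsMonotoneSubmodular f) (j : Fin n)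
    (S : Finset (Fin n)) : 0 ≤ discDeriv f j S :=
  sub_nonneg.2 (hf.mono ((Finset.erase_subset _ _).trans (Finset.subset_insert _ _)))

lemma IsMonotoneSubmodular.discDeriv_le_singleton (hf : IsMonotoneSubmodular f) (j : Fin n)
    (S : Finset (Fin n)) : discDeriv f j S ≤ f {j} := by
  have h := hf.submodular (S.erase j) {j}
  have h1 : S.erase j ∩ {j} = ∅ := by simp
  have h2 : S.erase j ∪ {j} = insert j S := by
    ext i; by_cases hi : i = j <;> simp [hi]
  rw [h1, h2] at h
  have := hf.nonneg ∅
  unfold discDeriv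
  linarith

lemma IsMonotoneSubmodular.discDeriv_discDeriv_nonpos (hf : IsMonotoneSubmodular f) (i j : Fin n)
    (S : Finset (Fin n)) : discDeriv (discDeriv f j) i S ≤ 0 := by
  unfold discDeriv
  by_cases hij : i = j
  · subst hij
    have h1 : (insert i S).erase i = S.erase i := by ext k; by_cases hk : k = i <;> simp [hk]
    have h2 : insert i (S.erase i) = insert i S := by ext k; by_cases hk : k = i <;> simp [hk]
    have h3 : (S.erase i).erase i = S.erase i := by ext k; by_cases hk : k = i <;> simp [hk]
    have h4 : insert i (insert i S) = insert i S := by simp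
    rw [h1, h2, h3, h4]
    simp
  · have h := hf.submodular ((insert i S).erase j) (insert j (S.erase i))
    have h1 : (insert i S).erase j ∩ insert j (S.erase i) = (S.erase i).erase j := by
      ext k; by_cases hk : k = i <;> by_cases hk' : k = j <;> simp_all
    have h2 : (insert i S).erase j ∪ insert j (S.erase i) = insert j (insert i S) := by
      ext k; by_cases hk : k = i <;> by_cases hk' : k = j <;> simp_all
    rw [h1, h2] at h
    linarith

lemma IsMonotoneSubmodular.abs_discDeriv_discDeriv_le (hf : IsMonotoneSubmodular f) (i j : Fin n)
    (S : Finset (Fin n)) : |discDeriv (discDeriv f j) i S| ≤ f {j} := by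
  rw [abs_of_nonpos (hf.discDeriv_discDeriv_nonpos i j S)]
  have h1 := hf.discDeriv_nonneg j (insert i S)
  have h2 := hf.discDeriv_le_singleton j (S.erase i)
  change -(discDeriv f j (insert i S) - discDeriv f j (S.erase i)) ≤ _
  linarith

lemma singleton_le_maxSingleton (f : Finset (Fin n) → ℝ) (j : Fin n) : f {j} ≤ maxSingleton f :=
  le_ciSup (f := fun j : Fin n => f {j}) (Set.finite_range _).bddAbove j

lemma IsMonotoneSubmodular.maxSingleton_nonneg (hf : IsMonotoneSubmodular f) :
    0 ≤ maxSingleton f :=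
  Real.iSup_nonneg fun _ => hf.nonneg _

lemma IsMonotoneSubmodular.grad_nonneg (hf : IsMonotoneSubmodular f)
    {x : EuclideanSpace ℝ (Fin n)} (hx : x ∈ unitCube n) (j : Fin n) :
    0 ≤ multilinearGrad f x j :=
  le_multilinearExt (hf.discDeriv_nonneg j) hx

lemma IsMonotoneSubmodular.grad_le (hf : IsMonotoneSubmodular f)
    {x : EuclideanSpace ℝ (Fin n)} (hx : x ∈ unitCube n) (j : Fin n) :
    multilinearGrad f x j ≤ f {j} :=
  multilinearExt_le (hf.discDeriv_le_singleton j) hx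

/-- A bound for the Euclidean norm of a vector by a bound for its coordinates. -/
lemma EuclideanSpace.norm_le_sqrt_card_mul {y : EuclideanSpace ℝ (Fin n)} {b : ℝ} (hb : 0 ≤ b)
    (h : ∀ i, |y i| ≤ b) : ‖y‖ ≤ √n * b := by
  rw [EuclideanSpace.norm_eq, ← Real.sqrt_sq hb, ← Real.sqrt_mul (Nat.cast_nonneg n)]
  refine Real.sqrt_le_sqrt ((Finset.sum_le_card_nsmul _ _ (b ^ 2) fun i _ => ?_).trans_eq (by simp))
  rw [Real.norm_eq_abs]
  exact pow_le_pow_left₀ (abs_nonneg _) (h i) 2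

lemma IsMonotoneSubmodular.norm_grad_le (hf : IsMonotoneSubmodular f)
    {x : EuclideanSpace ℝ (Fin n)} (hx : x ∈ unitCube n) :
    ‖multilinearGrad f x‖ ≤ √n * maxSingleton f :=
  EuclideanSpace.norm_le_sqrt_card_mul hf.maxSingleton_nonneg fun i => by
    rw [abs_of_nonneg (hf.grad_nonneg hx i)]
    exact (hf.grad_le hx i).trans (singleton_le_maxSingleton f i)

/-- The coordinates of `∇F` are Lipschitz with constant `m_f` for the `ℓ¹`-norm, as the second
partial derivatives of `F` are bounded by `m_f`. -/
lemma IsMonotoneSubmodular.abs_grad_sub_le (hf : IsMonotoneSubmodular f)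
    {x y : EuclideanSpace ℝ (Fin n)} (hx : x ∈ unitCube n) (hy : y ∈ unitCube n) (j : Fin n) :
    |multilinearGrad f y j - multilinearGrad f x j| ≤ maxSingleton f * ∑ i, |y i - x i| :=
  abs_multilinearExt_sub_le (fun i S => (hf.abs_discDeriv_discDeriv_le i j S).trans
    (singleton_le_maxSingleton f j)) hx hy

lemma IsMonotoneSubmodular.norm_grad_sub_le (hf : IsMonotoneSubmodular f)
    {x y : EuclideanSpace ℝ (Fin n)} (hx : x ∈ unitCube n) (hy : y ∈ unitCube n) :
    ‖multilinearGrad f y - multilinearGrad f x‖ ≤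
      √n * (maxSingleton f * ∑ i, |y i - x i|) :=
  EuclideanSpace.norm_le_sqrt_card_mul
    (mul_nonneg hf.maxSingleton_nonneg (Finset.sum_nonneg fun _ _ => abs_nonneg _))
    fun j => hf.abs_grad_sub_le hx hy j

lemma IsMonotoneSubmodular.multilinearExt_mono_on_cube (hf : IsMonotoneSubmodular f)
    {x y : EuclideanSpace ℝ (Fin n)} (hx : x ∈ unitCube n) (hy : y ∈ unitCube n)
    (hxy : ∀ i, x i ≤ y i) : multilinearExt f x ≤ multilinearExt f y := by
  obtain ⟨w, hw, h⟩ := exists_multilinearExt_sub_eq f x y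
  have hw' := (convex_unitCube n).segment_subset hx hy hw
  rw [← sub_nonneg, h]
  exact Finset.sum_nonneg fun i _ => mul_nonneg (hf.grad_nonneg hw' i) (sub_nonneg.2 (hxy i))

/-- `F` is concave along nonnegative directions. -/
lemma IsMonotoneSubmodular.multilinearExt_sub_le (hf : IsMonotoneSubmodular f)
    {x y : EuclideanSpace ℝ (Fin n)} (hx : x ∈ unitCube n) (hy : y ∈ unitCube n)
    (hxy : ∀ i, x i ≤ y i) :
    multilinearExt f y - multilinearExt f x ≤ ∑ i, multilinearGrad f x i * (y i - x i) := by
  obtain ⟨w, hw, h⟩ := exists_multilinearExt_sub_eq f x y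
  have hw' := (convex_unitCube n).segment_subset hx hy hw
  have hxw : ∀ i, x i ≤ w i := by
    obtain ⟨a, b, ha, hb, hab, rfl⟩ := hw
    intro i
    have := mul_nonneg hb (sub_nonneg.2 (hxy i))
    simp only [PiLp.add_apply, PiLp.smul_apply, smul_eq_mul]
    rw [show a = 1 - b by linarith]
    linarith
  rw [h]
  refine Finset.sum_le_sum fun i _ => mul_le_mul_of_nonneg_right ?_ (sub_nonneg.2 (hxy i))
  exact multilinearExt_antitone (fun k S => hf.discDeriv_discDeriv_nonpos k i S) hx hw' hxw

/-- The key inequality of continuous greedy: passing from `x` to `x ⊔ y` gains at least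
`F(y) - F(x)` by monotonicity and at most `⟨∇F(x), y⟩` by concavity along `x ⊔ y - x ≤ y`. -/
lemma IsMonotoneSubmodular.sub_le_inner_grad (hf : IsMonotoneSubmodular f)
    {x y : EuclideanSpace ℝ (Fin n)} (hx : x ∈ unitCube n) (hy : y ∈ unitCube n) :
    multilinearExt f y - multilinearExt f x ≤ inner ℝ (multilinearGrad f x) y := by
  set w : EuclideanSpace ℝ (Fin n) := WithLp.toLp 2 fun i => max (x i) (y i) with hw
  have hwi (i : Fin n) : w i = max (x i) (y i) := rfl
  have hw' : w ∈ unitCube n := fun i =>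
    ⟨(hx i).1.trans (le_max_left _ _), max_le (hx i).2 (hy i).2⟩
  have h1 := hf.multilinearExt_mono_on_cube hy hw' fun i => le_max_right _ _
  have h2 := hf.multilinearExt_sub_le hx hw' fun i => le_max_left _ _
  have h3 : ∑ i, multilinearGrad f x i * (w i - x i) ≤ inner ℝ (multilinearGrad f x) y := by
    rw [PiLp.inner_apply]
    refine Finset.sum_le_sum fun i _ => ?_
    rw [RCLike.inner_apply, conj_trivial, mul_comm (y i)]
    refine mul_le_mul_of_nonneg_left ?_ (hf.grad_nonneg hx i)
    rw [hwi, sub_le_iff_le_add]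
    exact max_le (by linarith [(hy i).1]) (by linarith [(hx i).1])
  linarith

/-- A second-order lower bound for `F`, with the error measured in the `ℓ¹`-norm. -/
lemma IsMonotoneSubmodular.inner_grad_sub_le (hf : IsMonotoneSubmodular f)
    {x y : EuclideanSpace ℝ (Fin n)} (hx : x ∈ unitCube n) (hy : y ∈ unitCube n) :
    inner ℝ (multilinearGrad f x) (y - x) - maxSingleton f * (∑ i, |y i - x i|) ^ 2 ≤
      multilinearExt f y - multilinearExt f x := by
  obtain ⟨w, hw, h⟩ := exists_multilinearExt_sub_eq f x y
  have hw' := (convex_unitCube n).segment_subset hx hy hw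
  have hxw : ∑ i, |w i - x i| ≤ ∑ i, |y i - x i| := by
    obtain ⟨a, b, ha, hb, hab, rfl⟩ := hw
    refine Finset.sum_le_sum fun i _ => ?_
    have : (a • x + b • y) i - x i = b * (y i - x i) := by
      simp only [PiLp.add_apply, PiLp.smul_apply, smul_eq_mul]
      rw [show a = 1 - b by linarith]
      ring
    rw [this, abs_mul, abs_of_nonneg hb]
    exact mul_le_of_le_one_left (abs_nonneg _) (by linarith)
  have hterm (i : Fin n) : multilinearGrad f x i * (y i - x i) -
      maxSingleton f * (∑ k, |y k - x k|) * |y i - x i| ≤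
        multilinearExt (discDeriv f i) w * (y i - x i) := by
    have h1 : |multilinearGrad f w i - multilinearGrad f x i| ≤
        maxSingleton f * ∑ k, |y k - x k| :=
      (hf.abs_grad_sub_le hx hw' i).trans (mul_le_mul_of_nonneg_left hxw hf.maxSingleton_nonneg)
    have h2 := neg_abs_le ((multilinearGrad f w i - multilinearGrad f x i) * (y i - x i))
    rw [abs_mul] at h2
    have h3 := mul_le_mul_of_nonneg_right h1 (abs_nonneg (y i - x i))
    rw [← multilinearGrad_apply]
    linarith
  rw [h, PiLp.inner_apply, sq, ← mul_assoc, Finset.mul_sum, ← Finset.sum_sub_distrib]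
  refine Finset.sum_le_sum fun i _ => le_trans (le_of_eq ?_) (hterm i)
  rw [RCLike.inner_apply, conj_trivial, PiLp.sub_apply, mul_comm (y i - x i)]

end Submodular

/-! ### Matroid polytopes -/

section Polytope

variable {n : ℕ}

lemma matroidPolytope_subset_unitCube (M : Matroid (Fin n)) :
    matroidPolytope M ⊆ unitCube n := by
  refine convexHull_min ?_ (convex_unitCube n)
  rintro _ ⟨I, -, rfl⟩ i
  by_cases h : i ∈ I <;> simp [indicatorVec, h]

lemma sum_le_of_mem_matroidPolytope {M : Matroid (Fin n)} {r : ℕ} (hM : M.eRank ≤ r)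
    {x : EuclideanSpace ℝ (Fin n)} (hx : x ∈ matroidPolytope M) : ∑ i, x i ≤ r := by
  have hconv : Convex ℝ {x : EuclideanSpace ℝ (Fin n) | ∑ i, x i ≤ r} := by
    refine convex_halfSpace_le (f := fun x : EuclideanSpace ℝ (Fin n) => ∑ i, x i) ⟨?_, ?_⟩ _
    · intro x y; simp [Finset.sum_add_distrib]
    · intro c x; simp [Finset.mul_sum]
  refine convexHull_min ?_ hconv hx
  rintro _ ⟨I, hI, rfl⟩
  have h := hI.encard_le_eRank.trans hM
  rw [Set.encard_coe_eq_coe_finsetCard] at h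
  simpa [indicatorVec] using h

lemma zero_mem_matroidPolytope (M : Matroid (Fin n)) : 0 ∈ matroidPolytope M :=
  subset_convexHull ℝ _ ⟨∅, by simp, by ext i; simp [indicatorVec]⟩

/-- The Euclidean norm is at most the `ℓ¹`-norm. -/
lemma norm_le_sum_of_mem_unitCube {x : EuclideanSpace ℝ (Fin n)} (hx : x ∈ unitCube n) :
    ‖x‖ ≤ ∑ i, x i := by
  refine abs_le_of_sq_le_sq' ?_ (Finset.sum_nonneg fun i _ => (hx i).1) |>.2
  rw [EuclideanSpace.norm_sq_eq]
  simp only [Real.norm_eq_abs, sq_abs]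
  exact Finset.sum_sq_le_sq_sum_of_nonneg fun i _ => (hx i).1

end Polytope

/-! ### The noise of one stochastic gradient -/

section Noise

variable {n : ℕ} {Z : Type v} [MeasurableSpace Z] {P : Measure Z} [IsProbabilityMeasure P]
  {f : Finset (Fin n) → ℝ} {G : EuclideanSpace ℝ (Fin n) → Z → EuclideanSpace ℝ (Fin n)} {σ : ℝ}

lemma measurableSet_unitCube (n : ℕ) : MeasurableSet (unitCube n) := by
  have : unitCube n = ⋂ i, {x : EuclideanSpace ℝ (Fin n) | 0 ≤ x i ∧ x i ≤ 1} := by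
    ext x; simp [unitCube]
  rw [this]
  refine MeasurableSet.iInter fun i => ?_
  have hi : Measurable fun x : EuclideanSpace ℝ (Fin n) => x i :=
    (by fun_prop : Continuous fun x : EuclideanSpace ℝ (Fin n) => x i).measurable
  exact (measurableSet_le measurable_const hi).inter (measurableSet_le hi measurable_const)

/-- The noise `ξ = ∇F(X) - G(X, z)` of a stochastic gradient at a random point `X` of the past, for
a fresh sample `z`, has second moment at most `σ²` and is orthogonal in `L²` to every random vector
`W` of the past. By independence the joint law of `((X, W), z)` is a product, and both claims follow
from Fubini's theorem. -/
lemma noise_estimates {Ω : Type u} {m' mΩ : MeasurableSpace Ω} (hm : m' ≤ mΩ) {μ : Measure Ω}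
    [IsProbabilityMeasure μ] (hG : IsUnbiasedGrad P (multilinearExt f) G)
    (hvar : BoundedVariance P (multilinearExt f) G σ) {X W : Ω → EuclideanSpace ℝ (Fin n)}
    (hX : Measurable[m'] X) (hW : Measurable[m'] W) (hXc : ∀ ω, X ω ∈ unitCube n)
    {z : Ω → Z} (hz : Measurable z) (hlaw : μ.map z = P)
    (hind : Indep m' (MeasurableSpace.comap z inferInstance) μ) (hW2 : MemLp W 2 μ) :
    MemLp (fun ω => multilinearGrad f (X ω) - G (X ω) (z ω)) 2 μ ∧
      ∫ ω, ‖multilinearGrad f (X ω) - G (X ω) (z ω)‖ ^ 2 ∂μ ≤ σ ^ 2 ∧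
      ∫ ω, inner ℝ (W ω) (multilinearGrad f (X ω) - G (X ω) (z ω)) ∂μ = 0 := by
  have hX' : Measurable X := hX.mono hm le_rfl
  have hW' : Measurable W := hW.mono hm le_rfl
  set H : Ω → EuclideanSpace ℝ (Fin n) × EuclideanSpace ℝ (Fin n) := fun ω => (X ω, W ω)
  have hH : Measurable H := hX'.prodMk hW'
  have hHm : Measurable[m'] H := hX.prodMk hW
  have hindH : IndepFun H z μ := by
    rw [IndepFun_iff_Indep]
    exact indep_of_indep_of_le_left hind hHm.comap_le
  have hjoint : μ.map (fun ω => (H ω, z ω)) = (μ.map H).prod P := by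
    rw [← hlaw]
    exact (indepFun_iff_map_prod_eq_prod_map_map hH.aemeasurable hz.aemeasurable).1 hindH
  have : IsProbabilityMeasure (μ.map H) := Measure.isProbabilityMeasure_map hH.aemeasurable
  have hHz : Measurable fun ω => (H ω, z ω) := hH.prodMk hz
  set φ : (EuclideanSpace ℝ (Fin n) × EuclideanSpace ℝ (Fin n)) × Z → EuclideanSpace ℝ (Fin n) :=
    fun p => multilinearGrad f p.1.1 - G p.1.1 p.2 with hφ
  have hφm : Measurable φ := by
    refine Measurable.sub ?_ ?_
    · exact (continuous_multilinearGrad f).measurable.comp (measurable_fst.comp measurable_fst)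
    · exact hG.measurable.comp ((measurable_fst.comp measurable_fst).prodMk measurable_snd)
  have hcube : ∀ᵐ h ∂(μ.map H), h.1 ∈ unitCube n := by
    rw [ae_map_iff hH.aemeasurable (measurable_fst (measurableSet_unitCube n))]
    exact Filter.Eventually.of_forall hXc
  have hsec : ∀ x ∈ unitCube n, Integrable (fun w => ‖multilinearGrad f x - G x w‖ ^ 2) P ∧
      ∫ w, ‖multilinearGrad f x - G x w‖ ^ 2 ∂P ≤ σ ^ 2 := by
    intro x hx
    have h := hvar x hx
    simp only [gradient_multilinearExt, norm_sub_rev (G x _)] at h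
    exact h
  have hsq : Integrable (fun p => ‖φ p‖ ^ 2) ((μ.map H).prod P) := by
    rw [integrable_prod_iff (hφm.norm.pow_const 2).aestronglyMeasurable]
    refine ⟨?_, ?_⟩
    · filter_upwards [hcube] with h hh using (hsec h.1 hh).1
    · refine Integrable.of_bound (C := σ ^ 2) ?_ ?_
      · have hs := (hφm.norm.pow_const 2).norm.stronglyMeasurable (α := _ × Z)
        exact hs.integral_prod_right'.aestronglyMeasurable
      · filter_upwards [hcube] with h hh
        rw [Real.norm_of_nonneg (integral_nonneg fun w => norm_nonneg _)]
        simp only [norm_pow, norm_norm]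
        exact (hsec h.1 hh).2
  have hsqμ : Integrable (fun ω => ‖φ (H ω, z ω)‖ ^ 2) μ := by
    rw [← hjoint] at hsq
    exact hsq.comp_measurable hHz
  have hmem : MemLp (fun ω => φ (H ω, z ω)) 2 μ :=
    (memLp_two_iff_integrable_sq_norm (hφm.comp hHz).aestronglyMeasurable).2 hsqμ
  refine ⟨hmem, ?_, ?_⟩
  · have h1 : ∫ ω, ‖φ (H ω, z ω)‖ ^ 2 ∂μ = ∫ p, ‖φ p‖ ^ 2 ∂((μ.map H).prod P) := by
      rw [← hjoint, integral_map hHz.aemeasurable (hφm.norm.pow_const 2).aestronglyMeasurable]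
    change ∫ ω, ‖φ (H ω, z ω)‖ ^ 2 ∂μ ≤ _
    rw [h1, integral_prod _ hsq]
    refine (integral_mono_ae hsq.integral_prod_left (integrable_const (σ ^ 2)) ?_).trans_eq
      (by simp)
    filter_upwards [hcube] with h hh using (hsec h.1 hh).2
  · have hinm : Measurable fun p : (EuclideanSpace ℝ (Fin n) × EuclideanSpace ℝ (Fin n)) × Z =>
        (inner ℝ p.1.2 (φ p) : ℝ) := (measurable_snd.comp measurable_fst).inner hφm
    have hin : Integrable (fun p => (inner ℝ p.1.2 (φ p) : ℝ)) ((μ.map H).prod P) := by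
      rw [← hjoint, integrable_map_measure hinm.aestronglyMeasurable hHz.aemeasurable]
      refine Integrable.mono (hW2.norm.integrable_mul hmem.norm)
        (hinm.comp hHz).aestronglyMeasurable (Filter.Eventually.of_forall fun ω => ?_)
      refine (norm_inner_le_norm _ _).trans (le_abs_self _)
    have h1 : ∫ ω, (inner ℝ (W ω) (φ (H ω, z ω)) : ℝ) ∂μ =
        ∫ p, (inner ℝ p.1.2 (φ p) : ℝ) ∂((μ.map H).prod P) := by
      rw [← hjoint, integral_map hHz.aemeasurable hinm.aestronglyMeasurable]
    change ∫ ω, (inner ℝ (W ω) (φ (H ω, z ω)) : ℝ) ∂μ = 0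
    rw [h1, integral_prod _ hin]
    refine integral_eq_zero_of_ae ?_
    filter_upwards [hcube] with h hh
    have hi := hG.integrable h.1 hh
    have hi' : Integrable (fun w => φ (h, w)) P :=
      Integrable.sub (f := fun _ => multilinearGrad f h.1) (g := G h.1) (integrable_const _) hi
    have hz0 : ∫ w, φ (h, w) ∂P = 0 := by
      simp only [hφ]
      rw [integral_sub (integrable_const _) hi, hG.unbiased h.1 hh, gradient_multilinearExt]
      simp
    change ∫ w, (inner ℝ h.2 (φ (h, w)) : ℝ) ∂P = 0
    rw [integral_inner hi' h.2, hz0, inner_zero_right]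

end Noise

/-! ### Scalar estimates -/

section Scalar

lemma rpow_one_third_pow_three {a : ℝ} (ha : 0 ≤ a) : (a ^ (1 / 3 : ℝ)) ^ 3 = a := by
  rw [← Real.rpow_mul_natCast ha]
  norm_num

lemma scgRho_eq (t : ℕ) : scgRho t = 4 / (((t : ℝ) + 8) ^ (1 / 3 : ℝ)) ^ 2 := by
  rw [scgRho, ← Real.rpow_mul_natCast (by positivity)]
  norm_num

lemma two_le_rpow_one_third (t : ℕ) : 2 ≤ ((t : ℝ) + 8) ^ (1 / 3 : ℝ) := by
  have h := rpow_one_third_pow_three (a := (t : ℝ) + 8) (by positivity)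
  refine le_of_pow_le_pow_left₀ (n := 3) (by norm_num) (by positivity) ?_
  rw [h]
  have : (0 : ℝ) ≤ t := t.cast_nonneg
  linarith

lemma scgRho_pos (t : ℕ) : 0 < scgRho t := by
  unfold scgRho; positivity

lemma scgRho_le_one (t : ℕ) : scgRho t ≤ 1 := by
  have h := two_le_rpow_one_third t
  rw [scgRho_eq, div_le_one (by positivity)]
  nlinarith

/-- The recursion `a_t ≤ (1 - 4/s²) a_{t-1} + K/s⁴`, `s = (t + 8)^{1/3}`, preserves the bound
`a_t ≤ Q/s²` as soon as `K ≤ Q`; here `u` is the value of `s` one step earlier. -/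
lemma averaging_step_le {s u K Q a : ℝ} (hs : 2 ≤ s) (hu : 1 ≤ u) (h : s ^ 3 = u ^ 3 + 1)
    (hK : 0 ≤ K) (hKQ : K ≤ Q) (ha : a ≤ Q / u ^ 2) :
    (1 - 4 / s ^ 2) * a + K / s ^ 4 ≤ Q / s ^ 2 := by
  have hQ : 0 ≤ Q := hK.trans hKQ
  have hs0 : 0 < s := by linarith
  have hu0 : 0 < u := by linarith
  have h4 : 0 ≤ 1 - 4 / s ^ 2 := by
    rw [sub_nonneg, div_le_one (by positivity)]
    nlinarith
  have hus : 0 ≤ s - u := sub_nonneg.2 (le_of_pow_le_pow_left₀ three_ne_zero hs0.le (by linarith))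
  have hdiff : s ^ 2 - u ^ 2 ≤ 1 := by
    have h1 : (s - u) * (s ^ 2 + s * u + u ^ 2) = 1 := by linear_combination h
    have h2 : (s - u) * (s + u) ≤ (s - u) * (s ^ 2 + s * u + u ^ 2) :=
      mul_le_mul_of_nonneg_left (by nlinarith) hus
    linarith
  have key : (1 - 4 / s ^ 2) / u ^ 2 + 1 / s ^ 4 ≤ 1 / s ^ 2 := by
    have e : 1 / s ^ 2 - ((1 - 4 / s ^ 2) / u ^ 2 + 1 / s ^ 4) =
        (s ^ 2 * u ^ 2 - (s ^ 2 - 4) * s ^ 2 - u ^ 2) / (s ^ 4 * u ^ 2) := by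
      field_simp
      ring
    rw [← sub_nonneg, e]
    refine div_nonneg ?_ (by positivity)
    nlinarith [sq_nonneg s]
  calc (1 - 4 / s ^ 2) * a + K / s ^ 4
      ≤ (1 - 4 / s ^ 2) * (Q / u ^ 2) + Q / s ^ 4 := by gcongr
    _ = Q * ((1 - 4 / s ^ 2) / u ^ 2 + 1 / s ^ 4) := by ring
    _ ≤ Q * (1 / s ^ 2) := by gcongr
    _ = Q / s ^ 2 := by ring

/-- Comparison of `k ^ (-1/3)` with an increment of `(3/2) k ^ (2/3)`. -/
lemma inv_rpow_one_third_le (k : ℕ) :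
    1 / ((k : ℝ) + 1) ^ (1 / 3 : ℝ) ≤
      3 / 2 * (((k : ℝ) + 1) ^ (1 / 3 : ℝ)) ^ 2 - 3 / 2 * ((k : ℝ) ^ (1 / 3 : ℝ)) ^ 2 := by
  have ha := rpow_one_third_pow_three (a := (k : ℝ)) (by positivity)
  have hb := rpow_one_third_pow_three (a := (k : ℝ) + 1) (by positivity)
  have ha0 : 0 ≤ (k : ℝ) ^ (1 / 3 : ℝ) := by positivity
  have hb0 : 0 < ((k : ℝ) + 1) ^ (1 / 3 : ℝ) := by positivity
  generalize (k : ℝ) ^ (1 / 3 : ℝ) = a at *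
  generalize ((k : ℝ) + 1) ^ (1 / 3 : ℝ) = b at *
  rw [div_le_iff₀ hb0]
  have h : 0 ≤ (b - a) ^ 2 * (b + 2 * a) := by positivity
  nlinarith

/-- The contraction of the squared error under a drift of norm at most `b`. -/
lemma sq_mul_norm_add_sq_le {E : Type*} [NormedAddCommGroup E] {ρ b : ℝ} (h0 : 0 < ρ) (h1 : ρ ≤ 1)
    {D e : E} (hb : ‖D‖ ≤ b) :
    (1 - ρ) ^ 2 * ‖D + e‖ ^ 2 ≤ (1 - ρ) * ‖e‖ ^ 2 + 2 / ρ * b ^ 2 := by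
  have hb0 : 0 ≤ b := (norm_nonneg _).trans hb
  have hnorm : ‖D + e‖ ^ 2 ≤ (b + ‖e‖) ^ 2 :=
    pow_le_pow_left₀ (norm_nonneg _) ((norm_add_le _ _).trans (by linarith)) 2
  generalize ‖e‖ = q at *
  -- Young's inequality with weight `ρ / 2`: half of the contraction pays for the drift
  have hyoung : (b + q) ^ 2 ≤ (1 + ρ / 2) * q ^ 2 + (ρ + 2) / ρ * b ^ 2 := by
    have e1 : (1 + ρ / 2) * q ^ 2 + (ρ + 2) / ρ * b ^ 2 - (b + q) ^ 2 =
        (ρ * q - 2 * b) ^ 2 / (2 * ρ) := by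
      field_simp
      ring
    have : 0 ≤ (ρ * q - 2 * b) ^ 2 / (2 * ρ) := by positivity
    linarith
  have hq : (1 - ρ) ^ 2 * (1 + ρ / 2) ≤ 1 - ρ := by
    have h2 : (1 - ρ) * (1 + ρ / 2) ≤ 1 := by nlinarith
    have h3 := mul_le_mul_of_nonneg_left h2 (sub_nonneg.2 h1)
    linarith
  have hb' : (1 - ρ) ^ 2 * (ρ + 2) ≤ 2 := by nlinarith [mul_pos h0 h0]
  calc (1 - ρ) ^ 2 * ‖D + e‖ ^ 2
      ≤ (1 - ρ) ^ 2 * ((1 + ρ / 2) * q ^ 2 + (ρ + 2) / ρ * b ^ 2) :=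
        mul_le_mul_of_nonneg_left (hnorm.trans hyoung) (sq_nonneg _)
    _ = (1 - ρ) ^ 2 * (1 + ρ / 2) * q ^ 2 + (1 - ρ) ^ 2 * (ρ + 2) / ρ * b ^ 2 := by ring
    _ ≤ (1 - ρ) * q ^ 2 + 2 / ρ * b ^ 2 := by gcongr

end Scalar

/-! ### Second moments of random vectors -/

section SecondMoment

variable {Ω : Type u} {mΩ : MeasurableSpace Ω} {μ : Measure Ω}

lemma sq_integral_norm_le [IsProbabilityMeasure μ] {E : Type*} [NormedAddCommGroup E]
    {e : Ω → E} (he : MemLp e 2 μ) :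
    (∫ ω, ‖e ω‖ ∂μ) ^ 2 ≤ ∫ ω, ‖e ω‖ ^ 2 ∂μ := by
  have h := variance_eq_sub he.norm
  have h' := variance_nonneg (fun ω => ‖e ω‖) μ
  rw [h, sub_nonneg] at h'
  exact h'

/-- The contraction of the mean squared error under a drift of norm at most `b`. -/
lemma sq_mul_integral_norm_add_sq_le [IsProbabilityMeasure μ] {E : Type*} [NormedAddCommGroup E]
    {ρ b : ℝ} (h0 : 0 < ρ) (h1 : ρ ≤ 1) {D e : Ω → E} (hD : MemLp D 2 μ) (he : MemLp e 2 μ)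
    (hb : ∀ ω, ‖D ω‖ ≤ b) :
    (1 - ρ) ^ 2 * ∫ ω, ‖D ω + e ω‖ ^ 2 ∂μ ≤
      (1 - ρ) * ∫ ω, ‖e ω‖ ^ 2 ∂μ + 2 / ρ * b ^ 2 := by
  have hW : MemLp (fun ω => D ω + e ω) 2 μ := hD.add he
  have hWi := (memLp_two_iff_integrable_sq_norm hW.1).1 hW
  have hei := ((memLp_two_iff_integrable_sq_norm he.1).1 he).const_mul (1 - ρ)
  rw [← integral_const_mul, ← integral_const_mul]
  refine (integral_mono (hWi.const_mul _) (hei.add (integrable_const (2 / ρ * b ^ 2)))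
    fun ω => sq_mul_norm_add_sq_le h0 h1 (hb ω)).trans_eq ?_
  simp only [Pi.add_apply]
  rw [integral_add hei (integrable_const _)]
  simp

/-- Pythagoras' theorem for random vectors that are orthogonal in `L²`. -/
lemma integral_norm_smul_add_smul_sq {E : Type*} [NormedAddCommGroup E] [InnerProductSpace ℝ E]
    {W ξ : Ω → E} (hW : MemLp W 2 μ) (hξ : MemLp ξ 2 μ) (h : ∫ ω, (inner ℝ (W ω) (ξ ω) : ℝ) ∂μ = 0)
    (a b : ℝ) :
    ∫ ω, ‖a • W ω + b • ξ ω‖ ^ 2 ∂μ =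
      a ^ 2 * ∫ ω, ‖W ω‖ ^ 2 ∂μ + b ^ 2 * ∫ ω, ‖ξ ω‖ ^ 2 ∂μ := by
  have hWi := ((memLp_two_iff_integrable_sq_norm hW.1).1 hW).const_mul (a ^ 2)
  have hξi := ((memLp_two_iff_integrable_sq_norm hξ.1).1 hξ).const_mul (b ^ 2)
  have hini : Integrable (fun ω => (inner ℝ (W ω) (ξ ω) : ℝ)) μ :=
    Integrable.mono (hW.norm.integrable_mul hξ.norm) (hW.1.inner hξ.1)
      (Filter.Eventually.of_forall fun ω => (norm_inner_le_norm _ _).trans (le_abs_self _))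
  have hexp (ω : Ω) : ‖a • W ω + b • ξ ω‖ ^ 2 =
      a ^ 2 * ‖W ω‖ ^ 2 + b ^ 2 * ‖ξ ω‖ ^ 2 + 2 * a * b * inner ℝ (W ω) (ξ ω) := by
    rw [norm_add_sq_real, norm_smul, norm_smul, mul_pow, mul_pow, real_inner_smul_left,
      real_inner_smul_right, Real.norm_eq_abs, Real.norm_eq_abs, sq_abs, sq_abs]
    ring
  have hsum : Integrable (fun ω => a ^ 2 * ‖W ω‖ ^ 2 + b ^ 2 * ‖ξ ω‖ ^ 2) μ := hWi.add hξi
  simp only [hexp]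
  rw [integral_add hsum (hini.const_mul _), integral_add hWi hξi, integral_const_mul,
    integral_const_mul, integral_const_mul, h, mul_zero, add_zero]

end SecondMoment

/-! ### Trajectories of Stochastic Continuous Greedy -/

namespace IsSCGRun

variable {n : ℕ} {Z : Type v} [MeasurableSpace Z] {P : Measure Z}
  {f : Finset (Fin n) → ℝ} {G : EuclideanSpace ℝ (Fin n) → Z → EuclideanSpace ℝ (Fin n)} {σ R : ℝ}
  {Ω : Type u} {mΩ : MeasurableSpace Ω} {μ : Measure Ω} {ℱ : Filtration ℕ mΩ}
  {𝒞 : Set (EuclideanSpace ℝ (Fin n))} {T t₀ : ℕ} {z : ℕ → Ω → Z}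
  {d v x : ℕ → Ω → EuclideanSpace ℝ (Fin n)}

/-- After `k` steps the iterate is `k / T` times an average of points of `𝒞`. -/
lemma exists_eq_smul (h : IsSCGRun μ ℱ P 𝒞 G T t₀ z d v x) (hT : 1 ≤ T) (hconv : Convex ℝ 𝒞)
    (h0 : 0 ∈ 𝒞) {k : ℕ} (hk : k ≤ T) (ω : Ω) :
    ∃ y ∈ 𝒞, x (t₀ + k) ω = ((k : ℝ) / T) • y := by
  have hT0 : (0 : ℝ) < T := by exact_mod_cast hT
  induction k with
  | zero => exact ⟨0, h0, by simp [h.x_zero t₀ le_rfl ω]⟩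
  | succ k ih =>
    obtain ⟨y, hy, hxy⟩ := ih (by omega)
    have hk0 : (0 : ℝ) < (k : ℝ) + 1 := by positivity
    refine ⟨((k : ℝ) / (k + 1)) • y + (1 / ((k : ℝ) + 1)) • v (t₀ + k) ω,
      hconv hy (h.v_mem (t₀ + k) (by omega) (by omega) ω) (by positivity) (by positivity)
        (by field_simp), ?_⟩
    rw [← add_assoc, h.x_step (t₀ + k) (by omega) (by omega) ω, hxy, smul_add, smul_smul, smul_smul]
    push_cast
    congr 2 <;> field_simp

lemma output_mem (h : IsSCGRun μ ℱ P 𝒞 G T t₀ z d v x) (hT : 1 ≤ T) (hconv : Convex ℝ 𝒞)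
    (h0 : 0 ∈ 𝒞) (ω : Ω) : x (t₀ + T) ω ∈ 𝒞 := by
  obtain ⟨y, hy, hxy⟩ := h.exists_eq_smul hT hconv h0 le_rfl ω
  rw [hxy, div_self (by positivity), one_smul]
  exact hy

lemma iterate_mem (h : IsSCGRun μ ℱ P 𝒞 G T t₀ z d v x) (hT : 1 ≤ T) (hconv : Convex ℝ 𝒞)
    (h0 : 0 ∈ 𝒞) {t : ℕ} (ht : t ≤ t₀ + T) (ω : Ω) : x t ω ∈ 𝒞 := by
  by_cases htt : t ≤ t₀
  · rw [h.x_zero t htt ω]; exact h0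
  · obtain ⟨k, rfl⟩ := Nat.exists_eq_add_of_le (le_of_not_ge htt)
    obtain ⟨y, hy, hxy⟩ := h.exists_eq_smul hT hconv h0 (k := k) (by omega) ω
    rw [hxy]
    refine hconv.smul_mem_of_zero_mem h0 hy ⟨by positivity, ?_⟩
    rw [div_le_one (by positivity)]
    exact_mod_cast (by omega : k ≤ T)

lemma measurable_iterate (h : IsSCGRun μ ℱ P 𝒞 G T t₀ z d v x) {t : ℕ} (ht : t ≤ t₀ + T) :
    Measurable[ℱ (t - 1)] (x t) := by
  induction t with
  | zero =>
    rw [show x 0 = fun _ => 0 from funext (h.x_zero 0 (Nat.zero_le _))]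
    exact measurable_const
  | succ t ih =>
    by_cases htt : t + 1 ≤ t₀
    · rw [show x (t + 1) = fun _ => 0 from funext (h.x_zero _ htt)]
      exact measurable_const
    · rw [show x (t + 1) = fun ω => x t ω + (1 / (T : ℝ)) • v t ω from
        funext (h.x_step t (by omega) (by omega))]
      have h1 : Measurable[ℱ t] (x t) := (ih (by omega)).mono (ℱ.mono (Nat.sub_le _ _)) le_rfl
      have h2 : Measurable[ℱ t] fun ω => (1 / (T : ℝ)) • v t ω :=
        (h.v_measurable t (by omega) (by omega)).const_smul (1 / (T : ℝ))
      exact h1.add h2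

lemma measurable_direction (h : IsSCGRun μ ℱ P 𝒞 G T t₀ z d v x)
    (hG : Measurable (Function.uncurry G)) {t : ℕ} (ht : t < t₀ + T) :
    Measurable[ℱ t] (d t) := by
  induction t with
  | zero =>
    rw [show d 0 = fun _ => 0 from funext h.d_zero]
    exact measurable_const
  | succ t ih =>
    rw [show d (t + 1) = fun ω => (1 - scgRho (t + 1)) • d t ω +
      scgRho (t + 1) • G (x (t + 1) ω) (z (t + 1) ω) from
        funext (h.d_step (t + 1) (by omega) ht)]
    have h1 : Measurable[ℱ (t + 1)] (d t) := (ih (by omega)).mono (ℱ.mono (Nat.le_succ _)) le_rfl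
    have h2 : Measurable[ℱ (t + 1)] (x (t + 1)) :=
      (h.measurable_iterate ht.le).mono (ℱ.mono (Nat.sub_le _ _)) le_rfl
    have h3 : Measurable[ℱ (t + 1)] fun ω => G (x (t + 1) ω) (z (t + 1) ω) :=
      hG.comp (h2.prodMk (h.sample_measurable (t + 1) (by omega) ht))
    have h4 : Measurable[ℱ (t + 1)] fun ω => (1 - scgRho (t + 1)) • d t ω :=
      h1.const_smul (1 - scgRho (t + 1))
    have h5 : Measurable[ℱ (t + 1)] fun ω => scgRho (t + 1) • G (x (t + 1) ω) (z (t + 1) ω) :=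
      h3.const_smul (scgRho (t + 1))
    exact h4.add h5

lemma measurable_gradError (h : IsSCGRun μ ℱ P 𝒞 G T t₀ z d v x)
    (hG : Measurable (Function.uncurry G)) {t : ℕ} (ht : t < t₀ + T) :
    Measurable fun ω => multilinearGrad f (x t ω) - d t ω :=
  ((continuous_multilinearGrad f).measurable.comp
    ((h.measurable_iterate ht.le).mono (ℱ.le _) le_rfl)).sub
    ((h.measurable_direction hG ht).mono (ℱ.le _) le_rfl)

/-- Consecutive iterates differ by at most `R / T` in the `ℓ¹`-norm. -/
lemma sum_abs_step_le (h : IsSCGRun μ ℱ P 𝒞 G T t₀ z d v x) (hcube : 𝒞 ⊆ unitCube n)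
    (hR0 : 0 ≤ R) (hR : ∀ y ∈ 𝒞, ∑ i, y i ≤ R) {t : ℕ} (ht : t < t₀ + T) (ω : Ω) :
    ∑ i, |x (t + 1) ω i - x t ω i| ≤ R / T := by
  by_cases htt : t + 1 ≤ t₀
  · simp only [h.x_zero _ htt ω, h.x_zero t (by omega) ω]
    simpa using by positivity
  · have hv := h.v_mem t (by omega) ht ω
    have (i : Fin n) : |x (t + 1) ω i - x t ω i| = 1 / (T : ℝ) * v t ω i := by
      rw [h.x_step t (by omega) ht ω, PiLp.add_apply, PiLp.smul_apply, add_sub_cancel_left,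
        smul_eq_mul, abs_of_nonneg (mul_nonneg (by positivity) (hcube hv i).1)]
    simp only [this]
    rw [← Finset.mul_sum, one_div_mul_eq_div]
    exact div_le_div_of_nonneg_right (hR _ hv) (Nat.cast_nonneg _)

/-- The progress of one step towards the value at a point `y` of `𝒞`. -/
lemma progress (h : IsSCGRun μ ℱ P 𝒞 G T t₀ z d v x) (hT : 1 ≤ T) (hconv : Convex ℝ 𝒞)
    (h0 : 0 ∈ 𝒞) (hcube : 𝒞 ⊆ unitCube n) (hR : ∀ y ∈ 𝒞, ∑ i, y i ≤ R)
    (hf : IsMonotoneSubmodular f) {y : EuclideanSpace ℝ (Fin n)} (hy : y ∈ 𝒞)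
    {t : ℕ} (ht0 : t₀ ≤ t) (ht : t < t₀ + T) (ω : Ω) :
    multilinearExt f (x t ω) + 1 / T * (multilinearExt f y - multilinearExt f (x t ω)) -
        2 * R / T * ‖multilinearGrad f (x t ω) - d t ω‖ - maxSingleton f * (R / T) ^ 2 ≤
      multilinearExt f (x (t + 1) ω) := by
  have hT0 : (0 : ℝ) < T := by exact_mod_cast hT
  have hR0 : 0 ≤ R := by simpa using hR 0 h0
  have hx := hcube (h.iterate_mem hT hconv h0 ht.le ω)
  have hx' := hcube (h.iterate_mem hT hconv h0 (Nat.succ_le_of_lt ht) ω)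
  have hv := h.v_mem t ht0 ht ω
  set g := multilinearGrad f (x t ω) with hg
  have h1 := hf.inner_grad_sub_le hx hx'
  have h2 : maxSingleton f * (∑ i, |x (t + 1) ω i - x t ω i|) ^ 2 ≤
      maxSingleton f * (R / T) ^ 2 :=
    mul_le_mul_of_nonneg_left (pow_le_pow_left₀ (Finset.sum_nonneg fun _ _ => abs_nonneg _)
      (h.sum_abs_step_le hcube hR0 hR ht ω) 2) hf.maxSingleton_nonneg
  have h3 : x (t + 1) ω - x t ω = (1 / (T : ℝ)) • v t ω := by
    rw [h.x_step t ht0 ht ω, add_sub_cancel_left]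
  rw [Nat.succ_eq_add_one, h3, real_inner_smul_right, ← hg] at h1
  have h4 : inner ℝ (d t ω) y ≤ inner ℝ (d t ω) (v t ω) := h.v_max t ht0 ht ω hy
  have h5 := hf.sub_le_inner_grad hx (hcube hy)
  have h6 : inner ℝ (g - d t ω) (y - v t ω) ≤ ‖g - d t ω‖ * (2 * R) := by
    refine (real_inner_le_norm _ _).trans (mul_le_mul_of_nonneg_left ?_ (norm_nonneg _))
    refine (norm_sub_le _ _).trans ?_
    linarith [norm_le_sum_of_mem_unitCube (hcube hy), norm_le_sum_of_mem_unitCube (hcube hv),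
      hR y hy, hR _ hv]
  rw [inner_sub_left, inner_sub_right, inner_sub_right] at h6
  have h7 : multilinearExt f y - multilinearExt f (x t ω) - 2 * R * ‖g - d t ω‖ ≤
      inner ℝ g (v t ω) := by
    rw [← hg] at h5
    linarith
  have h8 := mul_le_mul_of_nonneg_left h7 (by positivity : (0 : ℝ) ≤ 1 / T)
  have e : 2 * R / T * ‖g - d t ω‖ = 1 / T * (2 * R * ‖g - d t ω‖) := by ring
  rw [e]
  linarith

variable [IsProbabilityMeasure μ]

lemma integrable_multilinearExt_iterate (h : IsSCGRun μ ℱ P 𝒞 G T t₀ z d v x) (hT : 1 ≤ T)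
    (hconv : Convex ℝ 𝒞) (h0 : 0 ∈ 𝒞) (hcube : 𝒞 ⊆ unitCube n) (hf : IsMonotoneSubmodular f)
    {t : ℕ} (ht : t ≤ t₀ + T) : Integrable (fun ω => multilinearExt f (x t ω)) μ := by
  refine Integrable.of_bound (C := f Finset.univ) ?_ (Filter.Eventually.of_forall fun ω => ?_)
  · exact ((continuous_multilinearExt f).measurable.comp
      ((h.measurable_iterate ht).mono (ℱ.le _) le_rfl)).aestronglyMeasurable
  · have hx := hcube (h.iterate_mem hT hconv h0 ht ω)
    rw [Real.norm_of_nonneg (le_multilinearExt hf.nonneg hx)]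
    exact multilinearExt_le (fun S => hf.mono (Finset.subset_univ S)) hx

variable [IsProbabilityMeasure P]

/-- One averaging step: with `W = ∇F(x_t) - d_{t-1}` and the noise `ξ = ∇F(x_t) - G(x_t, z_t)`, the
new error is `(1 - ρ) W + ρ ξ`, the two summands being orthogonal in `L²`. -/
lemma gradError_step (h : IsSCGRun μ ℱ P 𝒞 G T t₀ z d v x) (hT : 1 ≤ T) (hconv : Convex ℝ 𝒞)
    (h0 : 0 ∈ 𝒞) (hcube : 𝒞 ⊆ unitCube n) (hR : ∀ y ∈ 𝒞, ∑ i, y i ≤ R)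
    (hf : IsMonotoneSubmodular f) (hG : IsUnbiasedGrad P (multilinearExt f) G)
    (hvar : BoundedVariance P (multilinearExt f) G σ) {t : ℕ} (ht : t + 1 < t₀ + T)
    (ih : MemLp (fun ω => multilinearGrad f (x t ω) - d t ω) 2 μ) :
    MemLp (fun ω => multilinearGrad f (x (t + 1) ω) - d (t + 1) ω) 2 μ ∧
      ∫ ω, ‖multilinearGrad f (x (t + 1) ω) - d (t + 1) ω‖ ^ 2 ∂μ ≤
        (1 - scgRho (t + 1)) * ∫ ω, ‖multilinearGrad f (x t ω) - d t ω‖ ^ 2 ∂μ +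
          2 / scgRho (t + 1) * (√n * (maxSingleton f * (R / T))) ^ 2 +
          scgRho (t + 1) ^ 2 * σ ^ 2 := by
  have hR0 : 0 ≤ R := by simpa using hR 0 h0
  set ρ := scgRho (t + 1) with hρ
  have hρ0 : 0 < ρ := scgRho_pos _
  have hρ1 : ρ ≤ 1 := scgRho_le_one _
  have hmem (s : ℕ) (hs : s ≤ t₀ + T) (ω : Ω) : x s ω ∈ unitCube n :=
    hcube (h.iterate_mem hT hconv h0 hs ω)
  have hXm : Measurable[ℱ t] (x (t + 1)) := by simpa using h.measurable_iterate ht.le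
  have hXt : Measurable[ℱ t] (x t) :=
    (h.measurable_iterate (by omega : t ≤ t₀ + T)).mono (ℱ.mono (Nat.sub_le _ _)) le_rfl
  have hgrad := (continuous_multilinearGrad f).measurable
  set W : Ω → EuclideanSpace ℝ (Fin n) := fun ω => multilinearGrad f (x (t + 1) ω) - d t ω
  set D : Ω → EuclideanSpace ℝ (Fin n) := fun ω =>
    multilinearGrad f (x (t + 1) ω) - multilinearGrad f (x t ω)
  have hWm : Measurable[ℱ t] W :=
    (hgrad.comp hXm).sub (h.measurable_direction hG.measurable (by omega : t < t₀ + T))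
  have hDm : Measurable[ℱ t] D := (hgrad.comp hXm).sub (hgrad.comp hXt)
  have hD (ω : Ω) : ‖D ω‖ ≤ √n * (maxSingleton f * (R / T)) := by
    refine (hf.norm_grad_sub_le (hmem t (by omega) ω) (hmem (t + 1) (by omega) ω)).trans ?_
    exact mul_le_mul_of_nonneg_left (mul_le_mul_of_nonneg_left
      (h.sum_abs_step_le hcube hR0 hR (by omega) ω) hf.maxSingleton_nonneg) (by positivity)
  have hDL : MemLp D 2 μ := MemLp.of_bound (hDm.mono (ℱ.le _) le_rfl).aestronglyMeasurable _
    (Filter.Eventually.of_forall hD)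
  have hWD : W = fun ω => D ω + (multilinearGrad f (x t ω) - d t ω) := by
    funext ω; simp only [W, D]; abel
  have hWL : MemLp W 2 μ := hWD ▸ hDL.add ih
  obtain ⟨hξL, hξ, horth⟩ := noise_estimates (ℱ.le t) hG hvar hXm hWm (hmem (t + 1) (by omega))
    ((h.sample_measurable (t + 1) (by omega) ht).mono (ℱ.le _) le_rfl)
    (h.sample_law (t + 1) (by omega) ht)
    (by simpa using h.sample_indep (t + 1) (by omega) ht) hWL
  set ξ : Ω → EuclideanSpace ℝ (Fin n) := fun ω =>
    multilinearGrad f (x (t + 1) ω) - G (x (t + 1) ω) (z (t + 1) ω)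
  have hstep : (fun ω => multilinearGrad f (x (t + 1) ω) - d (t + 1) ω) =
      fun ω => (1 - ρ) • W ω + ρ • ξ ω := by
    funext ω
    rw [h.d_step (t + 1) (by omega) ht ω]
    simp only [W, ξ, Nat.add_sub_cancel, ← hρ]
    module
  have hLp : MemLp (fun ω => (1 - ρ) • W ω + ρ • ξ ω) 2 μ :=
    (hWL.const_smul (1 - ρ)).add (hξL.const_smul ρ)
  refine ⟨hstep ▸ hLp, ?_⟩
  have hsq : ∫ ω, ‖multilinearGrad f (x (t + 1) ω) - d (t + 1) ω‖ ^ 2 ∂μ =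
      ∫ ω, ‖(1 - ρ) • W ω + ρ • ξ ω‖ ^ 2 ∂μ :=
    congrArg (fun u : Ω → EuclideanSpace ℝ (Fin n) => ∫ ω, ‖u ω‖ ^ 2 ∂μ) hstep
  rw [hsq, integral_norm_smul_add_smul_sq hWL hξL horth, hWD]
  exact add_le_add (sq_mul_integral_norm_add_sq_le hρ0 hρ1 hDL ih hD)
    (mul_le_mul_of_nonneg_left hξ (sq_nonneg _))

/-- The mean squared error of the averaged gradient estimate decays like `t ^ (-2/3)`. The
three terms bounded by `Q` stem from the noise (`ρ_t² = 16 (t + 8)^{-4/3}`), from the drift of the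
iterates, and from the initial estimate `d_0 = 0`, where `8^{2/3} = 4`. -/
lemma integral_gradError_sq_le (h : IsSCGRun μ ℱ P 𝒞 G T t₀ z d v x) (hT : 1 ≤ T)
    (hconv : Convex ℝ 𝒞) (h0 : 0 ∈ 𝒞) (hcube : 𝒞 ⊆ unitCube n) (hR : ∀ y ∈ 𝒞, ∑ i, y i ≤ R)
    (hf : IsMonotoneSubmodular f) (hG : IsUnbiasedGrad P (multilinearExt f) G)
    (hvar : BoundedVariance P (multilinearExt f) G σ) {Q : ℝ}
    (hQ : 16 * σ ^ 2 + 41 * (√n * (maxSingleton f * R)) ^ 2 + 4 * (√n * maxSingleton f) ^ 2 ≤ Q)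
    {t : ℕ} (ht : t < t₀ + T) :
    MemLp (fun ω => multilinearGrad f (x t ω) - d t ω) 2 μ ∧
      ∫ ω, ‖multilinearGrad f (x t ω) - d t ω‖ ^ 2 ∂μ ≤
        Q / (((t : ℝ) + 8) ^ (1 / 3 : ℝ)) ^ 2 := by
  have hT0 : (0 : ℝ) < T := by exact_mod_cast hT
  induction t with
  | zero =>
    have hb (ω : Ω) : ‖multilinearGrad f (x 0 ω) - d 0 ω‖ ≤ √n * maxSingleton f := by
      rw [h.d_zero, sub_zero]
      exact hf.norm_grad_le (hcube (h.iterate_mem hT hconv h0 (Nat.zero_le _) ω))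
    have hL : MemLp (fun ω => multilinearGrad f (x 0 ω) - d 0 ω) 2 μ :=
      MemLp.of_bound (h.measurable_gradError hG.measurable ht).aestronglyMeasurable _
        (Filter.Eventually.of_forall hb)
    refine ⟨hL, ?_⟩
    have h8 : (((0 : ℕ) : ℝ) + 8) ^ (1 / 3 : ℝ) = 2 := by
      rw [show ((0 : ℕ) : ℝ) + 8 = 2 ^ (3 : ℕ) by norm_num, one_div, show (3 : ℝ) = (3 : ℕ) by simp,
        Real.pow_rpow_inv_natCast (by norm_num) (by norm_num)]
    rw [h8]
    have h1 : ∫ ω, ‖multilinearGrad f (x 0 ω) - d 0 ω‖ ^ 2 ∂μ ≤ (√n * maxSingleton f) ^ 2 := by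
      refine (integral_mono ((memLp_two_iff_integrable_sq_norm hL.1).1 hL)
        (integrable_const _) fun ω => pow_le_pow_left₀ (norm_nonneg _) (hb ω) 2).trans_eq (by simp)
    have := sq_nonneg σ
    have := sq_nonneg (√n * (maxSingleton f * R))
    linarith
  | succ t ih =>
    obtain ⟨hL, ha⟩ := ih (by omega)
    obtain ⟨hL', hstep⟩ := h.gradError_step hT hconv h0 hcube hR hf hG hvar ht hL
    refine ⟨hL', hstep.trans ?_⟩
    have hs2 := two_le_rpow_one_third (t + 1)
    have hu2 := two_le_rpow_one_third t
    have hs3 := rpow_one_third_pow_three (a := ((t + 1 : ℕ) : ℝ) + 8) (by positivity)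
    have hu3 := rpow_one_third_pow_three (a := (t : ℝ) + 8) (by positivity)
    rw [scgRho_eq]
    generalize (((t + 1 : ℕ) : ℝ) + 8) ^ (1 / 3 : ℝ) = s at *
    generalize ((t : ℝ) + 8) ^ (1 / 3 : ℝ) = u at *
    have hs0 : 0 < s := by linarith
    -- the number of steps taken is at most `T`, so that `1 / T ≤ 9 / (t + 9)`
    have hTs : 1 / (T : ℝ) ≤ 9 / s ^ 3 := by
      have h1 : s ^ 3 ≤ 9 * T := by
        have h2 : t + 1 ≤ T := by have := h.start_le; omega
        have h3 : ((t + 1 : ℕ) : ℝ) ≤ T := by exact_mod_cast h2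
        have h4 : (1 : ℝ) ≤ T := by exact_mod_cast hT
        rw [hs3]
        linarith
      rw [div_le_div_iff₀ hT0 (by positivity)]
      linarith
    have hdrift : 2 / (4 / s ^ 2) * (√n * (maxSingleton f * (R / T))) ^ 2 ≤
        41 * (√n * (maxSingleton f * R)) ^ 2 / s ^ 4 := by
      have e1 : √n * (maxSingleton f * (R / T)) = √n * (maxSingleton f * R) * (1 / T) := by ring
      rw [e1, mul_pow]
      calc 2 / (4 / s ^ 2) * ((√n * (maxSingleton f * R)) ^ 2 * (1 / (T : ℝ)) ^ 2)
          ≤ 2 / (4 / s ^ 2) * ((√n * (maxSingleton f * R)) ^ 2 * (9 / s ^ 3) ^ 2) := by gcongr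
        _ = 40.5 * (√n * (maxSingleton f * R)) ^ 2 / s ^ 4 := by field_simp; ring
        _ ≤ 41 * (√n * (maxSingleton f * R)) ^ 2 / s ^ 4 := by gcongr; norm_num
    have hfin := averaging_step_le (s := s) (u := u) (Q := Q)
      (K := 16 * σ ^ 2 + 41 * (√n * (maxSingleton f * R)) ^ 2) hs2 (by linarith)
      (by rw [hs3, hu3]; push_cast; ring) (by positivity)
      (by have := sq_nonneg (√n * maxSingleton f); linarith) ha
    have e2 : (4 / s ^ 2) ^ 2 * σ ^ 2 = 16 * σ ^ 2 / s ^ 4 := by field_simp; ring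
    rw [e2]
    rw [add_div] at hfin
    linarith

/-- The rate of convergence of Stochastic Continuous Greedy: the distance to `(1 - 1/e) F(y)` is
governed by the sum of the expected gradient errors, `∑ t ^ (-1/3) ≤ (3/2) T ^ (2/3)`. -/
lemma le_integral_output (h : IsSCGRun μ ℱ P 𝒞 G T t₀ z d v x) (hT : 1 ≤ T)
    (hconv : Convex ℝ 𝒞) (h0 : 0 ∈ 𝒞) (hcube : 𝒞 ⊆ unitCube n) (hR : ∀ y ∈ 𝒞, ∑ i, y i ≤ R)
    (hf : IsMonotoneSubmodular f) (hG : IsUnbiasedGrad P (multilinearExt f) G)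
    (hvar : BoundedVariance P (multilinearExt f) G σ) {Q : ℝ}
    (hQ : 16 * σ ^ 2 + 41 * (√n * (maxSingleton f * R)) ^ 2 + 4 * (√n * maxSingleton f) ^ 2 ≤ Q)
    {y : EuclideanSpace ℝ (Fin n)} (hy : y ∈ 𝒞) :
    (1 - 1 / Real.exp 1) * multilinearExt f y -
        (3 * R * √Q + maxSingleton f * R ^ 2) / (T : ℝ) ^ (1 / 3 : ℝ) ≤
      ∫ ω, multilinearExt f (x (t₀ + T) ω) ∂μ := by
  have hT0 : (0 : ℝ) < T := by exact_mod_cast hT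
  have hT1 : (1 : ℝ) ≤ T := by exact_mod_cast hT
  have hR0 : 0 ≤ R := by simpa using hR 0 h0
  have hm0 := hf.maxSingleton_nonneg
  have hF0 := le_multilinearExt hf.nonneg (hcube hy)
  have hQ0 : 0 ≤ Q := le_trans (by positivity) hQ
  have herr (k : ℕ) (hk : k < T) :
      ∫ ω, ‖multilinearGrad f (x (t₀ + k) ω) - d (t₀ + k) ω‖ ∂μ ≤
        √Q * (1 / ((k : ℝ) + 1) ^ (1 / 3 : ℝ)) := by
    obtain ⟨hL, hb⟩ := h.integral_gradError_sq_le hT hconv h0 hcube hR hf hG hvar hQ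
      (by omega : t₀ + k < t₀ + T)
    -- the time `t₀ + k` is only bounded below by `k`, so one estimate serves both values of `t₀`
    have h1 := Real.le_sqrt_of_sq_le ((sq_integral_norm_le hL).trans hb)
    rw [Real.sqrt_div hQ0, Real.sqrt_sq (by positivity)] at h1
    refine h1.trans ?_
    rw [mul_one_div]
    gcongr
    · exact Nat.le_add_left k t₀
    · norm_num
  set A : ℕ → ℝ := fun k => multilinearExt f y - ∫ ω, multilinearExt f (x (t₀ + k) ω) ∂μ with hA
  have hAstep (k : ℕ) (hk : k < T) : A (k + 1) ≤ (1 - 1 / T) * A k +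
      2 * R / T * (√Q * (1 / ((k : ℝ) + 1) ^ (1 / 3 : ℝ))) + maxSingleton f * (R / T) ^ 2 := by
    have hi := h.integrable_multilinearExt_iterate hT hconv h0 hcube hf
      (by omega : t₀ + k ≤ t₀ + T)
    have hi' := h.integrable_multilinearExt_iterate hT hconv h0 hcube hf
      (by omega : t₀ + (k + 1) ≤ t₀ + T)
    have he := ((h.integral_gradError_sq_le hT hconv h0 hcube hR hf hG hvar hQ
      (by omega : t₀ + k < t₀ + T)).1.norm).integrable (by norm_num)
    have hi1 : Integrable (fun ω => (1 - 1 / (T : ℝ)) * multilinearExt f (x (t₀ + k) ω)) μ :=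
      hi.const_mul _
    have hi2 : Integrable (fun ω => 2 * R / T *
      ‖multilinearGrad f (x (t₀ + k) ω) - d (t₀ + k) ω‖) μ := he.const_mul _
    have hi12 : Integrable (fun ω => (1 - 1 / (T : ℝ)) * multilinearExt f (x (t₀ + k) ω) -
        2 * R / T * ‖multilinearGrad f (x (t₀ + k) ω) - d (t₀ + k) ω‖) μ := hi1.sub hi2
    have hmono : ∫ ω, ((1 - 1 / (T : ℝ)) * multilinearExt f (x (t₀ + k) ω) -
        2 * R / T * ‖multilinearGrad f (x (t₀ + k) ω) - d (t₀ + k) ω‖ +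
        (1 / T * multilinearExt f y - maxSingleton f * (R / T) ^ 2)) ∂μ ≤
          ∫ ω, multilinearExt f (x (t₀ + (k + 1)) ω) ∂μ := by
      refine integral_mono (hi12.add (integrable_const _)) hi' fun ω => ?_
      have := h.progress hT hconv h0 hcube hR hf hy (by omega : t₀ ≤ t₀ + k) (by omega) ω
      change _ ≤ multilinearExt f (x (t₀ + k + 1) ω)
      linarith
    rw [integral_add hi12 (integrable_const _), integral_sub hi1 hi2, integral_const_mul,
      integral_const_mul, integral_const, probReal_univ, one_smul] at hmono
    have h1 := mul_le_mul_of_nonneg_left (herr k hk) (by positivity : 0 ≤ 2 * R / (T : ℝ))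
    simp only [hA]
    linarith
  have hc0 : 0 ≤ 1 - 1 / (T : ℝ) := sub_nonneg.2 ((div_le_one hT0).2 hT1)
  have hc1 : 1 - 1 / (T : ℝ) ≤ 1 := sub_le_self _ (by positivity)
  have hAk (k : ℕ) (hk : k ≤ T) : A k ≤ (1 - 1 / T) ^ k * multilinearExt f y +
      2 * R / T * (√Q * (3 / 2 * ((k : ℝ) ^ (1 / 3 : ℝ)) ^ 2)) +
      k * (maxSingleton f * (R / T) ^ 2) := by
    induction k with
    | zero =>
      -- the run starts at `x = 0`, where `F` takes the value `f ∅ ≥ 0`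
      have hx0 : ∫ ω, multilinearExt f (x (t₀ + 0) ω) ∂μ = f ∅ := by
        simp [h.x_zero t₀ le_rfl, multilinearExt_zero]
      have := hf.nonneg ∅
      simp only [hA, hx0, pow_zero, Nat.cast_zero]
      rw [Real.zero_rpow (by norm_num)]
      linarith
    | succ k ih =>
      have h1 := hAstep k (by omega)
      have h2 := mul_le_mul_of_nonneg_left (ih (by omega)) hc0
      have hX : 0 ≤ 2 * R / T * (√Q * (3 / 2 * ((k : ℝ) ^ (1 / 3 : ℝ)) ^ 2)) := by positivity
      have hY : 0 ≤ k * (maxSingleton f * (R / T) ^ 2) := by positivity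
      have h3 := mul_le_of_le_one_left hX hc1
      have h4 := mul_le_of_le_one_left hY hc1
      have h5 := mul_le_mul_of_nonneg_left (mul_le_mul_of_nonneg_left (inv_rpow_one_third_le k)
        (Real.sqrt_nonneg Q)) (by positivity : 0 ≤ 2 * R / (T : ℝ))
      push_cast
      rw [pow_succ]
      linarith
  have hfin := hAk T le_rfl
  have hexp : (1 - 1 / (T : ℝ)) ^ T ≤ 1 / Real.exp 1 := by
    rw [one_div (Real.exp 1), ← Real.exp_neg]
    exact Real.one_sub_div_pow_le_exp_neg hT1
  have h1 := mul_le_mul_of_nonneg_right hexp hF0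
  have hb3 := rpow_one_third_pow_three hT0.le
  have hb1 : 1 ≤ (T : ℝ) ^ (1 / 3 : ℝ) := Real.one_le_rpow hT1 (by norm_num)
  simp only [hA] at hfin
  generalize (T : ℝ) ^ (1 / 3 : ℝ) = b at *
  have hb0 : 0 < b := by linarith
  have e1 : 2 * R / T * (√Q * (3 / 2 * b ^ 2)) = 3 * R * √Q / b := by
    rw [← hb3]; field_simp
  have e2 : T * (maxSingleton f * (R / T) ^ 2) ≤ maxSingleton f * R ^ 2 / b := by
    have : (T : ℝ) * (maxSingleton f * (R / T) ^ 2) = maxSingleton f * R ^ 2 / T := by field_simp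
    rw [this, ← hb3]
    gcongr
    exact le_self_pow₀ hb1 (by norm_num)
  rw [e1] at hfin
  rw [add_div]
  linarith

end IsSCGRun

/-! ### The number of iterations -/

section Guarantee

variable {n : ℕ} {f : Finset (Fin n) → ℝ}

/-- The constant in the bound `C n^{3/2} / ε³` on the number of iterations: the error of a run is at
most `√n (3 r √q + |m| r²) / T^{1/3}` with `q = 16 κ² + 41 (m r)² + 4 m²`. The summand `1` only
ensures positivity. -/
noncomputable def scgConst (r : ℕ) (m κ : ℝ) : ℝ :=
  (3 * r * √(16 * κ ^ 2 + 41 * (|m| * r) ^ 2 + 4 * |m| ^ 2) + |m| * r ^ 2) ^ 3 + 1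

lemma scgConst_pos (r : ℕ) (m κ : ℝ) : 0 < scgConst r m κ := by
  unfold scgConst; positivity

/-- The factor `√n` is harmless also for `n = 0`, where `m_f` is a supremum over the empty set. -/
lemma maxSingleton_le_sqrt_mul {m : ℝ} (hm : maxSingleton f ≤ m) :
    maxSingleton f ≤ √n * |m| := by
  rcases Nat.eq_zero_or_pos n with rfl | hn
  · simp [maxSingleton]
  · have h1 : 1 ≤ √(n : ℝ) := Real.one_le_sqrt.2 (by exact_mod_cast hn)
    exact (hm.trans (le_abs_self m)).trans (le_mul_of_one_le_left (abs_nonneg m) h1)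

/-- The number of iterations makes the error bound of a run at most `ε`. -/
lemma error_le_of_iterations_ge {r : ℕ} {m κ ε : ℝ} (hε : 0 < ε) {T : ℕ} (hT : 1 ≤ T)
    (hTC : scgConst r m κ * (n : ℝ) ^ (3 / 2 : ℝ) / ε ^ 3 ≤ T) :
    √n * (3 * r * √(16 * κ ^ 2 + 41 * (|m| * r) ^ 2 + 4 * |m| ^ 2) + |m| * r ^ 2) /
      (T : ℝ) ^ (1 / 3 : ℝ) ≤ ε := by
  have hT0 : (0 : ℝ) < T := by exact_mod_cast hT
  unfold scgConst at hTC
  set c := 3 * r * √(16 * κ ^ 2 + 41 * (|m| * r) ^ 2 + 4 * |m| ^ 2) + |m| * r ^ 2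
  have hn : (n : ℝ) ^ (3 / 2 : ℝ) = √n ^ 3 := by
    rw [Real.sqrt_eq_rpow, ← Real.rpow_mul_natCast (by positivity)]
    norm_num
  rw [hn, div_le_iff₀ (by positivity)] at hTC
  rw [div_le_iff₀ (by positivity)]
  refine le_of_pow_le_pow_left₀ three_ne_zero (by positivity) ?_
  rw [mul_pow, mul_pow, rpow_one_third_pow_three hT0.le]
  have : 0 ≤ √(n : ℝ) ^ 3 := by positivity
  linarith

variable {Z : Type v} [MeasurableSpace Z] {P : Measure Z} [IsProbabilityMeasure P]
  {G : EuclideanSpace ℝ (Fin n) → Z → EuclideanSpace ℝ (Fin n)}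

theorem scgAchieves_of_iterations_ge {r : ℕ} {m κ : ℝ} (hf : IsMonotoneSubmodular f)
    (hG : IsUnbiasedGrad P (multilinearExt f) G)
    (hvar : BoundedVariance P (multilinearExt f) G (√(n : ℝ) * κ)) {M : Matroid (Fin n)}
    (hM : M.eRank ≤ r) (hm : maxSingleton f ≤ m) {ε : ℝ} (hε : 0 < ε) {T : ℕ} (hT : 1 ≤ T)
    (hTC : scgConst r m κ * (n : ℝ) ^ (3 / 2 : ℝ) / ε ^ 3 ≤ T) :
    SCGAchieves.{u} P (multilinearExt f) (matroidPolytope M) G T ε := by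
  intro Ω mΩ μ _ ℱ t₀ z d v x h
  have hconv : Convex ℝ (matroidPolytope M) := convex_convexHull ℝ _
  have h0 := zero_mem_matroidPolytope M
  have hcube := matroidPolytope_subset_unitCube M
  have hR : ∀ y ∈ matroidPolytope M, ∑ i, y i ≤ (r : ℝ) :=
    fun y hy => sum_le_of_mem_matroidPolytope hM hy
  refine ⟨h.output_mem hT hconv h0,
    h.integrable_multilinearExt_iterate hT hconv h0 hcube hf le_rfl, ?_⟩
  set q := 16 * κ ^ 2 + 41 * (|m| * r) ^ 2 + 4 * |m| ^ 2 with hq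
  have hm0 := hf.maxSingleton_nonneg
  have hm1 : maxSingleton f ≤ |m| := hm.trans (le_abs_self m)
  have hQ : 16 * (√(n : ℝ) * κ) ^ 2 + 41 * (√n * (maxSingleton f * r)) ^ 2 +
      4 * (√n * maxSingleton f) ^ 2 ≤ n * q := by
    have e : n * q = 16 * (√(n : ℝ) * κ) ^ 2 + 41 * (√n * (|m| * r)) ^ 2 + 4 * (√n * |m|) ^ 2 := by
      simp only [mul_pow, Real.sq_sqrt (Nat.cast_nonneg n), hq]
      ring
    rw [e]
    gcongr
  have herr : (3 * r * √(n * q) + maxSingleton f * r ^ 2) / (T : ℝ) ^ (1 / 3 : ℝ) ≤ ε := by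
    refine le_trans ?_ (error_le_of_iterations_ge hε hT hTC)
    refine div_le_div_of_nonneg_right ?_ (by positivity)
    rw [Real.sqrt_mul (Nat.cast_nonneg n)]
    have := mul_le_mul_of_nonneg_right (maxSingleton_le_sqrt_mul hm) (sq_nonneg (r : ℝ))
    linarith
  have hbound : ∀ y ∈ matroidPolytope M, (1 - 1 / Real.exp 1) * multilinearExt f y - ε ≤
      ∫ ω, multilinearExt f (x (t₀ + T) ω) ∂μ := fun y hy => by
    have := h.le_integral_output hT hconv h0 hcube hR hf hG hvar hQ hy
    linarith
  have he : 0 < 1 - 1 / Real.exp 1 := by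
    rw [sub_pos, div_lt_one (Real.exp_pos 1), Real.one_lt_exp_iff]
    exact one_pos
  have hopt : optValue (multilinearExt f) (matroidPolytope M) ≤
      (∫ ω, multilinearExt f (x (t₀ + T) ω) ∂μ + ε) / (1 - 1 / Real.exp 1) := by
    refine csSup_le (Set.Nonempty.image _ ⟨0, h0⟩) ?_
    rintro _ ⟨y, hy, rfl⟩
    rw [le_div_iff₀ he]
    linarith [hbound y hy]
  rw [le_div_iff₀ he] at hopt
  linarith

end Guarantee

/-! ### Stochastic submodular functions -/

lemma stochGrad_apply {n : ℕ} {Z : Type v} (ft : Finset (Fin n) → Z → ℝ)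
    (x : EuclideanSpace ℝ (Fin n)) (z : Z) (j : Fin n) :
    stochGrad ft x z j = multilinearExt (discDeriv (fun S => ft S z) j) x := by
  rw [stochGrad, gradient_multilinearExt, multilinearGrad_apply]

namespace IsStochMonotoneSubmodular

variable {n : ℕ} {Z : Type v} [MeasurableSpace Z] {P : Measure Z} {ft : Finset (Fin n) → Z → ℝ}

lemma isMonotoneSubmodular_expectedSetFun (h : IsStochMonotoneSubmodular P ft) :
    IsMonotoneSubmodular (expectedSetFun P ft) where
  nonneg S := integral_nonneg_of_ae (h.realization.mono fun _ hz => hz.nonneg S)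
  mono S S' hS := integral_mono_ae (h.integrable S) (h.integrable S')
    (h.realization.mono fun _ hz => hz.mono hS)
  submodular A B := by
    unfold expectedSetFun
    rw [← integral_add (h.integrable _) (h.integrable _),
      ← integral_add (h.integrable _) (h.integrable _)]
    exact integral_mono_ae ((h.integrable _).add (h.integrable _))
      ((h.integrable _).add (h.integrable _)) (h.realization.mono fun _ hz => hz.submodular A B)

lemma integrable_discDeriv (h : IsStochMonotoneSubmodular P ft) (j : Fin n)
    (S : Finset (Fin n)) : Integrable (fun z => discDeriv (fun S => ft S z) j S) P :=
  (h.integrable _).sub (h.integrable _)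

lemma integral_discDeriv (h : IsStochMonotoneSubmodular P ft) (j : Fin n)
    (S : Finset (Fin n)) :
    ∫ z, discDeriv (fun S => ft S z) j S ∂P = discDeriv (expectedSetFun P ft) j S :=
  integral_sub (h.integrable _) (h.integrable _)

lemma measurable_stochGrad (h : IsStochMonotoneSubmodular P ft) :
    Measurable (Function.uncurry (stochGrad ft)) := by
  have e : Function.uncurry (stochGrad ft) = fun p => WithLp.toLp 2 fun j =>
      multilinearExt (discDeriv (fun S => ft S p.2) j) p.1 := by
    funext p
    ext j
    exact stochGrad_apply ft p.1 p.2 j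
  rw [e]
  refine (WithLp.measurable_toLp 2 _).comp (measurable_pi_lambda _ fun j => ?_)
  unfold multilinearExt
  refine Finset.measurable_sum _ fun S _ => Measurable.mul ?_ ?_
  · exact ((h.measurable _).comp measurable_snd).sub ((h.measurable _).comp measurable_snd)
  · have hc : Continuous fun x : EuclideanSpace ℝ (Fin n) =>
        (∏ i ∈ S, x i) * ∏ j ∈ Sᶜ, (1 - x j) := by fun_prop
    exact hc.measurable.comp measurable_fst

lemma integrable_stochGrad_apply (h : IsStochMonotoneSubmodular P ft)
    (x : EuclideanSpace ℝ (Fin n)) (j : Fin n) : Integrable (fun z => stochGrad ft x z j) P := by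
  simp only [stochGrad_apply, multilinearExt]
  exact integrable_finsetSum _ fun S _ => (h.integrable_discDeriv j S).mul_const _

lemma integral_stochGrad_apply (h : IsStochMonotoneSubmodular P ft)
    (x : EuclideanSpace ℝ (Fin n)) (j : Fin n) :
    ∫ z, stochGrad ft x z j ∂P = multilinearGrad (expectedSetFun P ft) x j := by
  simp only [stochGrad_apply, multilinearGrad_apply, multilinearExt]
  rw [integral_finsetSum _ fun S _ => (h.integrable_discDeriv j S).mul_const _]
  refine Finset.sum_congr rfl fun S _ => ?_
  rw [integral_mul_const, h.integral_discDeriv]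

lemma isUnbiasedGrad_stochGrad (h : IsStochMonotoneSubmodular P ft) :
    IsUnbiasedGrad P (multilinearExt (expectedSetFun P ft)) (stochGrad ft) where
  measurable := h.measurable_stochGrad
  integrable x _ := Integrable.of_eval_piLp fun j => h.integrable_stochGrad_apply x j
  unbiased x _ := by
    ext j
    rw [eval_integral_piLp fun j => h.integrable_stochGrad_apply x j,
      h.integral_stochGrad_apply, gradient_multilinearExt]

/-- Almost surely, each coordinate of the stochastic gradient lies between `0` and the value of
the realization at the corresponding singleton. -/
lemma ae_stochGrad_apply_mem (h : IsStochMonotoneSubmodular P ft) {x : EuclideanSpace ℝ (Fin n)}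
    (hx : x ∈ unitCube n) (j : Fin n) :
    ∀ᵐ z ∂P, 0 ≤ stochGrad ft x z j ∧ stochGrad ft x z j ≤ ft {j} z := by
  filter_upwards [h.realization] with z hz
  rw [stochGrad, gradient_multilinearExt]
  exact ⟨hz.grad_nonneg hx j, hz.grad_le hx j⟩

lemma memLp_stochGrad_apply (h : IsStochMonotoneSubmodular P ft) {x : EuclideanSpace ℝ (Fin n)}
    (hx : x ∈ unitCube n) (j : Fin n) : MemLp (fun z => stochGrad ft x z j) 2 P := by
  refine ((memLp_two_iff_integrable_sq (h.measurable {j}).aestronglyMeasurable).2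
    (h.moment j)).mono (h.integrable_stochGrad_apply x j).1 ?_
  filter_upwards [h.ae_stochGrad_apply_mem hx j] with z hz
  rw [Real.norm_of_nonneg hz.1]
  exact hz.2.trans (le_abs_self _)

lemma integral_sq_le_maxSecondMoment_sq (P : Measure Z) (ft : Finset (Fin n) → Z → ℝ)
    (j : Fin n) : ∫ z, ft {j} z ^ 2 ∂P ≤ maxSecondMoment P ft ^ 2 := by
  have h : √(∫ z, ft {j} z ^ 2 ∂P) ≤ maxSecondMoment P ft :=
    le_ciSup (f := fun j : Fin n => √(∫ z, ft {j} z ^ 2 ∂P)) (Set.finite_range _).bddAbove j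
  exact (Real.sqrt_le_left (Real.iSup_nonneg fun _ => Real.sqrt_nonneg _)).1 h

lemma boundedVariance_stochGrad [IsProbabilityMeasure P] (h : IsStochMonotoneSubmodular P ft) :
    BoundedVariance P (multilinearExt (expectedSetFun P ft)) (stochGrad ft)
      (√(n : ℝ) * maxSecondMoment P ft) := by
  intro x hx
  have e (z : Z) : ‖stochGrad ft x z - gradient (multilinearExt (expectedSetFun P ft)) x‖ ^ 2 =
      ∑ j, (stochGrad ft x z j - ∫ w, stochGrad ft x w j ∂P) ^ 2 := by
    rw [EuclideanSpace.norm_sq_eq, gradient_multilinearExt]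
    simp only [PiLp.sub_apply, Real.norm_eq_abs, sq_abs, h.integral_stochGrad_apply]
  have hi (j : Fin n) :
      Integrable (fun z => (stochGrad ft x z j - ∫ w, stochGrad ft x w j ∂P) ^ 2) P :=
    ((h.memLp_stochGrad_apply hx j).sub (memLp_const _)).integrable_sq
  simp only [e]
  refine ⟨integrable_finsetSum _ fun j _ => hi j, ?_⟩
  rw [integral_finsetSum _ fun j _ => hi j, mul_pow, Real.sq_sqrt (Nat.cast_nonneg n)]
  refine (Finset.sum_le_card_nsmul _ _ (maxSecondMoment P ft ^ 2) fun j _ => ?_).trans_eq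
    (by simp)
  have hL := h.memLp_stochGrad_apply hx j
  rw [← variance_eq_integral hL.1.aemeasurable]
  refine (variance_le_expectation_sq hL.1).trans ?_
  refine le_trans ?_ (integral_sq_le_maxSecondMoment_sq P ft j)
  refine integral_mono_ae hL.integrable_sq (h.moment j) ?_
  filter_upwards [h.ae_stochGrad_apply_mem hx j] with z hz
  exact pow_le_pow_left₀ hz.1 hz.2 2

end IsStochMonotoneSubmodular

lemma BoundedVariance.mono {n : ℕ} {Z : Type v} [MeasurableSpace Z] {P : Measure Z}
    {F : EuclideanSpace ℝ (Fin n) → ℝ} {G : EuclideanSpace ℝ (Fin n) → Z → EuclideanSpace ℝ (Fin n)}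
    {σ σ' : ℝ} (h : BoundedVariance P F G σ) (h0 : 0 ≤ σ) (hσ : σ ≤ σ') :
    BoundedVariance P F G σ' :=
  fun x hx => ⟨(h x hx).1, (h x hx).2.trans (pow_le_pow_left₀ h0 hσ 2)⟩

/-! ### Iteration complexity of Stochastic Continuous Greedy -/

theorem mainTheorem3 (r : ℕ) (m κ : ℝ) :
    ∃ C : ℝ, 0 < C ∧
      -- stochastic monotone submodular functions: the bound on `σ` and the iteration count
      (∀ (n : ℕ) (Z : Type v) [MeasurableSpace Z] (P : Measure Z) [IsProbabilityMeasure P]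
        (ft : Finset (Fin n) → Z → ℝ), IsStochMonotoneSubmodular P ft →
        BoundedVariance P (multilinearExt (expectedSetFun P ft)) (stochGrad ft)
            (√(n : ℝ) * maxSecondMoment P ft) ∧
        ∀ M : Matroid (Fin n), M.eRank ≤ r → maxSingleton (expectedSetFun P ft) ≤ m →
          maxSecondMoment P ft ≤ κ →
          ∀ ε : ℝ, 0 < ε → ∀ T : ℕ, 1 ≤ T → C * (n : ℝ) ^ (3 / 2 : ℝ) / ε ^ 3 ≤ T →
            SCGAchieves.{u} P (multilinearExt (expectedSetFun P ft)) (matroidPolytope M)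
              (stochGrad ft) T ε) ∧
      -- only the expected function is monotone submodular, and `G` is any unbiased stochastic
      -- gradient of bounded variance, with `σ = √n κ`
      (∀ (n : ℕ) (Z : Type v) [MeasurableSpace Z] (P : Measure Z) [IsProbabilityMeasure P]
        (f : Finset (Fin n) → ℝ)
        (G : EuclideanSpace ℝ (Fin n) → Z → EuclideanSpace ℝ (Fin n)),
        IsMonotoneSubmodular f →
        IsUnbiasedGrad P (multilinearExt f) G →
        BoundedVariance P (multilinearExt f) G (√(n : ℝ) * κ) →
        ∀ M : Matroid (Fin n), M.eRank ≤ r → maxSingleton f ≤ m →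
          ∀ ε : ℝ, 0 < ε → ∀ T : ℕ, 1 ≤ T → C * (n : ℝ) ^ (3 / 2 : ℝ) / ε ^ 3 ≤ T →
            SCGAchieves.{u} P (multilinearExt f) (matroidPolytope M) G T ε) := by
  refine ⟨scgConst r m κ, scgConst_pos r m κ, ?_, ?_⟩
  · intro n Z _ P _ ft h
    refine ⟨h.boundedVariance_stochGrad, fun M hM hm hκ ε hε T hT hTC => ?_⟩
    have hσ0 : 0 ≤ maxSecondMoment P ft := Real.iSup_nonneg fun _ => Real.sqrt_nonneg _
    exact scgAchieves_of_iterations_ge h.isMonotoneSubmodular_expectedSetFun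
      h.isUnbiasedGrad_stochGrad (h.boundedVariance_stochGrad.mono (by positivity)
        (mul_le_mul_of_nonneg_left hκ (Real.sqrt_nonneg _))) hM hm hε hT hTC
  · intro n Z _ P _ f G hf hG hvar M hM hm ε hε T hT hTC
    exact scgAchieves_of_iterations_ge hf hG hvar hM hm hε hT hTC
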